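/- **Setting.** Let $1\le m\le n$. Write $w(s)$ for the Laplace transform of a signal $w(t)$. Vectors carry the norm $\|\cdot\|_\infty$, matrices the induced norm, and $\|w\|_{\mathcal L_\infty}=\sup_{t\ge 0}\|w(t)\|_\infty$ for a signal $w$. For a stable proper transfer matrix $H(s)$, $\|H(s)\|_{\mathcal L_1}$ is the supremum of $\|y\|_{\mathcal L_\infty}$ over all outputs $y$ produced from zero initial state by inputs with $\mathcal L_\infty$-norm at most $1$. *Plant and nominal system.* Let $A\in\mathbb R^{n\times n}$, $B\in\mathbb R^{n\times m}$, $K_x\in\mathbb R^{m\times n}$, $K_v\in\mathbb R^{m\times m}$, with $A_m=A+BK_x$ Hurwitz and $B_v=BK_v$. Let $v:[0,\infty)\to\mathbb R^m$ be bounded and measurable, and $x_0\in\mathcal X_0$ with $\mathcal X_0\subset\mathbb R^n$ compact. Consider $$\dot x=A_mx+B_vv+B\big(u_a+f(t,x)\big),\quad x(0)=x_0,\qquad u=K_xx+K_vv+u_a,$$ $$\dot x_n=A_mx_n+B_vv,\quad x_n(0)=x_0,\qquad u_n=K_xx_n+K_vv .$$ For every compact $\mathcal Z\subset\mathbb R^n$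 there are given positive constants $L_{f_j,\mathcal Z},l_{f_j,\mathcal Z},b_{f_j,\mathcal Z}$ $(1\le j\le m)$ such that, for all $x,z\in\mathcal Z$ and $t,\tau\ge0$, $|f_j(t,x)-f_j(\tau,z)|\le L_{f_j,\mathcal Z}\|x-z\|_\infty+l_{f_j,\mathcal Z}|t-\tau|$ and $|f_j(t,x)|\le b_{f_j,\mathcal Z}$. Put $L_{f,\mathcal Z}=\max_jL_{f_j,\mathcal Z}$ and $b_{f,\mathcal Z}=\max_jb_{f_j,\mathcal Z}$. *Adaptive controller.* Let $A_e\in\mathbb R^{n\times n}$ be Hurwitz, let $B^\perp\in\mathbb R^{n\times(n-m)}$ satisfy $(B^\perp)^\top B=0$ and $\operatorname{rank}[B\ B^\perp]=n$, let $T>0$, $\Phi(T)=A_e^{-1}(e^{A_eT}-I)$, and let $\mathcal C(s)=\operatorname{diag}(\mathcal C_1(s),\dots,\mathcal C_m(s))$ with $\mathcal C_j(s)=k_f^j/(s+k_f^j)$, $k_f^j>0$. With $\tilde x=\hat x-x$, the controller is $$\dot{\hat x}=A_mx+B_vv+B(u_a+\hat\sigma_1)+B^\perp\hat\sigma_2+A_e\tilde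 x,\quad \hat x(0)=x_0,$$ $$\begin{bmatrix}\hat\sigma_1(t)\\\hat\sigma_2(t)\end{bmatrix}=-[B\ B^\perp]^{-1}\Phi(T)^{-1}e^{A_eT}\tilde x(iT)\quad\text{for } t\in[iT,(i+1)T),\ i=0,1,2,\dots,\qquad u_a(s)=-\mathcal C(s)\hat\sigma_1(s).$$ *Constants.* Let $B^\dagger$ be the pseudo-inverse of $B$, let $H_{xm}(s)=(sI-A_m)^{-1}B$, $H_{xv}(s)=(sI-A_m)^{-1}B_v$, $G_{xm}(s)=H_{xm}(s)(I-\mathcal C(s))$, $\rho_{in}=\|s(sI-A_m)^{-1}\|_{\mathcal L_1}\max_{z\in\mathcal X_0}\|z\|_\infty$. For $\rho_r,\gamma_1>0$ put $\Omega(r)=\{z\in\mathbb R^n:\|z\|_\infty\le r\}$, $\mathcal X_a=\Omega(\rho_r+\gamma_1)$, and $$\bar\alpha_0=\int_0^T\|e^{A_e(T-\tau)}B\|_\infty d\tau,\quad \bar\alpha_1=\max_{t\in[0,T]}\|e^{A_et}\|_\infty,\quad \bar\alpha_2=\max_{t\in[0,T]}\int_0^t\|e^{A_e(t-\tau)}\Phi(T)^{-1}e^{A_eT}\|_\infty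 d\tau,$$ $$\gamma_0(T)=b_{f,\mathcal X_a}\bar\alpha_0(\bar\alpha_1+\bar\alpha_2+1),\qquad \gamma_2=\|\mathcal C(s)\|_{\mathcal L_1}L_{f,\mathcal X_a}\gamma_1+\|\mathcal C(s)B^\dagger(sI-A_e)\|_{\mathcal L_1}\gamma_0(T).$$ *Scaling.* For each $i\in\{1,\dots,n\}$ let $\mathsf T^i\in\mathbb R^{n\times n}$ be diagonal with $i$-th diagonal entry $1$ and all other diagonal entries in $(0,1]$. Put $\check A_m^i=\mathsf T^iA_m(\mathsf T^i)^{-1}$, $H^i_{\check xv}(s)=(sI-\check A^i_m)^{-1}\mathsf T^iB_v$, $G^i_{\check xm}(s)=(sI-\check A_m^i)^{-1}\mathsf T^iB(I-\mathcal C(s))$, $\check\rho_{in}^i=\|s\mathsf T^i(sI-A_m)^{-1}\|_{\mathcal L_1}\max_{z\in\mathcal X_0}\|z\|_\infty$, $\check f^i(t,\check z)=f(t,(\mathsf T^i)^{-1}\check z)$, and let $\check b^i=\max_j\check b^i_j$, where the constants $\check b^i_j$ are such that $|\check f^i_j(t,\check z)|\le\check b^i_j$ for all $t\ge0$, all $j$,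 and all $\check z$ with $(\mathsf T^i)^{-1}\check z\in\Omega(\rho_r)$. **Theorem.** Suppose that $$\|G_{xm}(s)\|_{\mathcal L_1}b_{f,\Omega(\rho_r)}<\rho_r-\|H_{xv}(s)\|_{\mathcal L_1}\|v\|_{\mathcal L_\infty}-\rho_{in},\qquad \|G_{xm}(s)\|_{\mathcal L_1}L_{f,\mathcal X_a}<1,$$ $$\frac{\|H_{xm}(s)\mathcal C(s)B^\dagger(sI-A_e)\|_{\mathcal L_1}}{1-\|G_{xm}(s)\|_{\mathcal L_1}L_{f,\mathcal X_a}}\,\gamma_0(T)<\gamma_1,$$ and that for each $i$ there is a constant $\check\rho_r^i>0$ with $$\|G^i_{\check xm}(s)\|_{\mathcal L_1}\check b^i<\check\rho_r^i-\|H^i_{\check xv}(s)\|_{\mathcal L_1}\|v\|_{\mathcal L_\infty}-\check\rho_{in}^i .$$ Let $\mathcal X_r=\{z\in\mathbb R^n:|z_i|\le\check\rho_r^i,\ 1\le i\le n\}$ and $$\tilde\rho^i=\|G^i_{\check xm}(s)\|_{\mathcal L_1}b_{f,\mathcal X_r}+\gamma_1,\qquad \rho_{u_a}^j=\|\mathcal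 C_j(s)\|_{\mathcal L_1}b_{f_j,\mathcal X_r}+\gamma_2 .$$ Then all solutions of the above systems on $[0,\infty)$ satisfy, for all $t\ge0$, $1\le i\le n$ and $1\le j\le m$, $$|x_i(t)-x_{n,i}(t)|\le\tilde\rho^i,\qquad |u_{a,j}(t)|\le\rho_{u_a}^j,\qquad |u_j(t)-u_{n,j}(t)|\le\rho_{u_a}^j+\sum_{i=1}^n|K_x[j,i]|\,\tilde\rho^i .$$ -/

import Mathlib

open MeasureTheory Matrix
open scoped ENNReal

noncomputable section

namespace L1Adaptive

/-! ### Signals, trajectories and norms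

Vectors are functions on `Fin n`, whose norm in Mathlib is the `∞`-norm. Signals are functions of
`t : ℝ` of which only the values at `t ≥ 0` matter. -/

/-- `x` is the (Carathéodory) solution of `ẋ(t) = g(t)`, `x(0) = x₀` on `[0, ∞)`; in the uses below
`g(t)` is the right-hand side evaluated along the trajectory. No continuity of `g` is required, so
that discontinuous reference commands and piecewise-constant estimates are covered. -/
def SolvesFrom {n : ℕ} (x₀ : Fin n → ℝ) (x g : ℝ → Fin n → ℝ) : Prop :=
  ∀ t : ℝ, 0 ≤ t →
    IntervalIntegrable g volume 0 t ∧ x t = x₀ + ∫ s in (0 : ℝ)..t, g s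

/-- `‖x‖_{L∞} = sup_{t ≥ 0} ‖x(t)‖_∞`. -/
def linfNorm {n : ℕ} (x : ℝ → Fin n → ℝ) : ℝ≥0∞ :=
  ⨆ (t : ℝ) (_ : 0 ≤ t), ENNReal.ofReal ‖x t‖

/-- The `∞`-norm of a matrix (the operator norm for the `∞`-norms, i.e. the maximal absolute row
sum). -/
def matNorm {p q : ℕ} (M : Matrix (Fin p) (Fin q) ℝ) : ℝ :=
  letI := Matrix.linftyOpNormedAddCommGroup (m := Fin p) (n := Fin q) (α := ℝ)
  ‖M‖

/-- A matrix is Hurwitz if all its complex eigenvalues have negative real part. -/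
def IsHurwitz {n : ℕ} (A : Matrix (Fin n) (Fin n) ℝ) : Prop :=
  ∀ z ∈ spectrum ℂ (A.map (algebraMap ℝ ℂ)), z.re < 0

/-- The pseudo-inverse `B† = (Bᵀ B)⁻¹ Bᵀ` of a matrix of full column rank. -/
def pinv {n m : ℕ} (B : Matrix (Fin n) (Fin m) ℝ) : Matrix (Fin m) (Fin n) ℝ :=
  (Bᵀ * B)⁻¹ * Bᵀ

/-! ### Transfer matrices and their `L₁` norm -/

/-- A `p × q` matrix of real rational functions of the Laplace variable `s`. -/
abbrev Transfer (p q : ℕ) : Type := Matrix (Fin p) (Fin q) (RatFunc ℝ)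

/-- The Laplace variable. -/
abbrev lapVar : RatFunc ℝ := RatFunc.X

/-- A real matrix as a constant transfer matrix. -/
def gain {p q : ℕ} (M : Matrix (Fin p) (Fin q) ℝ) : Transfer p q := M.map RatFunc.C

/-- `s I - A`. -/
def charMat {n : ℕ} (A : Matrix (Fin n) (Fin n) ℝ) : Transfer n n :=
  lapVar • (1 : Transfer n n) - gain A

/-- The state-space system `ẋ = A x + B u`, `y = C x + D u` has transfer matrix `H`. -/
def IsRealization {N p q : ℕ} (A : Matrix (Fin N) (Fin N) ℝ) (B : Matrix (Fin N) (Fin q) ℝ)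
    (C : Matrix (Fin p) (Fin N) ℝ) (D : Matrix (Fin p) (Fin q) ℝ) (H : Transfer p q) : Prop :=
  H = gain C * (charMat A)⁻¹ * gain B + gain D

/-- The `L₁` norm of a proper transfer matrix: the supremum of `‖y‖_{L∞}` over the responses `y`
of the system, from zero initial state, to the inputs `u` with `‖u‖_{L∞} ≤ 1`. The system is given
by a state-space realization; since the zero-state response is the same for all realizations of
`H`, the supremum is taken over all of them rather than for a chosen one. -/
def l1Norm {p q : ℕ} (H : Transfer p q) : ℝ≥0∞ :=
  ⨆ (N : ℕ) (A : Matrix (Fin N) (Fin N) ℝ) (B : Matrix (Fin N) (Fin q) ℝ)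
    (C : Matrix (Fin p) (Fin N) ℝ) (D : Matrix (Fin p) (Fin q) ℝ)
    (_ : IsRealization A B C D H)
    (u : ℝ → Fin q → ℝ) (_ : Measurable u) (_ : linfNorm u ≤ 1)
    (x : ℝ → Fin N → ℝ) (_ : SolvesFrom 0 x (fun t => A *ᵥ x t + B *ᵥ u t)),
    linfNorm (fun t => C *ᵥ x t + D *ᵥ u t)

/-- The first-order low-pass filter `C_j(s) = k / (s + k)`. -/
def lowPass (k : ℝ) : RatFunc ℝ := RatFunc.C k / (lapVar + RatFunc.C k)

/-- `C_j(s)` as a single-input single-output transfer matrix. -/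
def filterEntry (k : ℝ) : Transfer 1 1 := Matrix.of fun _ _ => lowPass k

/-- `C(s) = diag(C_1(s), …, C_m(s))`. -/
def filterTF {m : ℕ} (k : Fin m → ℝ) : Transfer m m := Matrix.diagonal fun j => lowPass (k j)

/-- `H(s) = (s I - A)⁻¹ B`. -/
def stateTransfer {n q : ℕ} (A : Matrix (Fin n) (Fin n) ℝ) (B : Matrix (Fin n) (Fin q) ℝ) :
    Transfer n q :=
  (charMat A)⁻¹ * gain B

/-- `G(s) = (s I - A)⁻¹ B (I - C(s))`. -/
def filteredTransfer {n m : ℕ} (A : Matrix (Fin n) (Fin n) ℝ) (B : Matrix (Fin n) (Fin m) ℝ)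
    (k : Fin m → ℝ) : Transfer n m :=
  stateTransfer A B * (1 - filterTF k)

/-! ### The uncertainty -/

/-- On the set `Z` and for nonnegative times, the `j`-th component of `f` is Lipschitz in the state
with constant `L j`, Lipschitz in time with constant `l j`, and bounded by `b j`. -/
def UncertaintyBounds {n m : ℕ} (f : ℝ → (Fin n → ℝ) → Fin m → ℝ) (Z : Set (Fin n → ℝ))
    (L l b : Fin m → ℝ) : Prop :=
  ∀ j, 0 < L j ∧ 0 < l j ∧ 0 < b j ∧
    ∀ x ∈ Z, ∀ z ∈ Z, ∀ t τ : ℝ, 0 ≤ t → 0 ≤ τ →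
      |f t x j - f τ z j| ≤ L j * ‖x - z‖ + l j * |t - τ| ∧ |f t x j| ≤ b j

/-- `Ω(ρ) = {z : ‖z‖_∞ ≤ ρ}`. -/
def Omega {n : ℕ} (ρ : ℝ) : Set (Fin n → ℝ) := {z | ‖z‖ ≤ ρ}

/-- The box `{z : |z_i| ≤ ρ_i for all i}`. -/
def box {n : ℕ} (ρ : Fin n → ℝ) : Set (Fin n → ℝ) := {z | ∀ i, |z i| ≤ ρ i}

/-- The transformed uncertainty `f̌(t, ž) = f(t, 𝖳⁻¹ ž)`. -/
def checkFun {n m : ℕ} (S : Matrix (Fin n) (Fin n) ℝ) (f : ℝ → (Fin n → ℝ) → Fin m → ℝ) :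
    ℝ → (Fin n → ℝ) → Fin m → ℝ :=
  fun t z => f t (S⁻¹ *ᵥ z)

/-- The transformed set `Ž = {ž : 𝖳⁻¹ ž ∈ Z}`. -/
def checkSet {n : ℕ} (S : Matrix (Fin n) (Fin n) ℝ) (Z : Set (Fin n → ℝ)) : Set (Fin n → ℝ) :=
  {z | S⁻¹ *ᵥ z ∈ Z}

/-! ### The plant, the baseline controller and the adaptive controller -/

/-- The matrices and tuning parameters of the plant `ẋ = A x + B (u + f(t, x))`, of the baseline
controller `K_x x + K_v v`, and of the adaptive controller: the predictor matrix `A_e`, the matrix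
`B^⊥`, the filter bandwidths `k_j` and the sample time `T`. -/
structure Params (n m : ℕ) where
  A : Matrix (Fin n) (Fin n) ℝ
  B : Matrix (Fin n) (Fin m) ℝ
  Kx : Matrix (Fin m) (Fin n) ℝ
  Kv : Matrix (Fin m) (Fin m) ℝ
  Ae : Matrix (Fin n) (Fin n) ℝ
  Bperp : Matrix (Fin n) (Fin (n - m)) ℝ
  k : Fin m → ℝ
  T : ℝ

namespace Params

variable {n m : ℕ} (P : Params n m)

/-- `A_m = A + B K_x`. -/
def Am : Matrix (Fin n) (Fin n) ℝ := P.A + P.B * P.Kx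

/-- `B_v = B K_v`. -/
def Bv : Matrix (Fin n) (Fin m) ℝ := P.B * P.Kv

/-- The square matrix `[B  B^⊥]`. -/
def BB (h : m ≤ n) : Matrix (Fin n) (Fin n) ℝ :=
  Matrix.of fun r c =>
    Fin.append (P.B r) (P.Bperp r) (Fin.cast (Nat.add_sub_of_le h).symm c)

/-- `Φ(T) = A_e⁻¹ (exp(A_e T) - I)`. -/
def Phi : Matrix (Fin n) (Fin n) ℝ := P.Ae⁻¹ * (NormedSpace.exp (P.T • P.Ae) - 1)

/-- The adaptive law: for `t ∈ [iT, (i+1)T)` the stacked estimate `(σ̂₁(t), σ̂₂(t))` equals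
`-[B B^⊥]⁻¹ Φ(T)⁻¹ exp(A_e T) x̃(iT)`. -/
def sigmaHat (h : m ≤ n) (xtilde : ℝ → Fin n → ℝ) (t : ℝ) : Fin n → ℝ :=
  -(((P.BB h)⁻¹ * P.Phi⁻¹ * NormedSpace.exp (P.T • P.Ae)) *ᵥ xtilde ((⌊t / P.T⌋₊ : ℝ) * P.T))

/-- The matched estimate `σ̂₁`: the first `m` components. -/
def sigma1 (h : m ≤ n) (xtilde : ℝ → Fin n → ℝ) (t : ℝ) : Fin m → ℝ :=
  fun j => P.sigmaHat h xtilde t (Fin.cast (Nat.add_sub_of_le h) (Fin.castAdd (n - m) j))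

/-- The unmatched estimate `σ̂₂`: the last `n - m` components. -/
def sigma2 (h : m ≤ n) (xtilde : ℝ → Fin n → ℝ) (t : ℝ) : Fin (n - m) → ℝ :=
  fun j => P.sigmaHat h xtilde t (Fin.cast (Nat.add_sub_of_le h) (Fin.natAdd m j))

/-- The nominal closed-loop system `ẋ_n = A_m x_n + B_v v`, `x_n(0) = x₀`. -/
def IsNominal (v : ℝ → Fin m → ℝ) (x₀ : Fin n → ℝ) (xn : ℝ → Fin n → ℝ) : Prop :=
  SolvesFrom x₀ xn (fun t => P.Am *ᵥ xn t + P.Bv *ᵥ v t)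

/-- The baseline law `K_x x + K_v v` along a state trajectory; for `x = x_n` this is the nominal
input `u_n`. -/
def baseline (v : ℝ → Fin m → ℝ) (x : ℝ → Fin n → ℝ) (t : ℝ) : Fin m → ℝ :=
  P.Kx *ᵥ x t + P.Kv *ᵥ v t

/-- The closed loop of the uncertain system, the state predictor (with state `xhat`), the
piecewise-constant adaptive law and the filtered control law. -/
structure IsClosedLoop (h : m ≤ n) (f : ℝ → (Fin n → ℝ) → Fin m → ℝ) (v : ℝ → Fin m → ℝ)
    (x₀ : Fin n → ℝ) (x xhat : ℝ → Fin n → ℝ) (ua : ℝ → Fin m → ℝ) : Prop where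
  plant : SolvesFrom x₀ x
    (fun t => P.Am *ᵥ x t + P.Bv *ᵥ v t + P.B *ᵥ (ua t + f t (x t)))
  predictor : SolvesFrom x₀ xhat
    (fun t => P.Am *ᵥ x t + P.Bv *ᵥ v t + P.B *ᵥ (ua t + P.sigma1 h (xhat - x) t)
      + P.Bperp *ᵥ P.sigma2 h (xhat - x) t + P.Ae *ᵥ (xhat t - x t))
  /-- The time-domain form of `u_a(s) = -C(s) 𝔏[σ̂₁]`: for each channel
  `u̇_{a,j} = -k_j u_{a,j} - k_j σ̂_{1,j}` with `u_{a,j}(0) = 0`. -/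
  control : SolvesFrom 0 ua
    (fun t j => -(P.k j * ua t j) - P.k j * P.sigma1 h (xhat - x) t j)

/-! ### Transfer matrices and constants of the performance analysis -/

/-- `H_{xm}(s) = (s I - A_m)⁻¹ B`. -/
def Hxm : Transfer n m := stateTransfer P.Am P.B

/-- `H_{xv}(s) = (s I - A_m)⁻¹ B_v`. -/
def Hxv : Transfer n m := stateTransfer P.Am P.Bv

/-- `G_{xm}(s) = H_{xm}(s) (I - C(s))`. -/
def Gxm : Transfer n m := filteredTransfer P.Am P.B P.k

/-- `C(s) B† (s I - A_e)`. -/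
def filterInv : Transfer m n := filterTF P.k * gain (pinv P.B) * charMat P.Ae

/-- `max_{x₀ ∈ X₀} ‖x₀‖_∞`. -/
def initRadius (X₀ : Set (Fin n → ℝ)) : ℝ := sSup ((fun z => ‖z‖) '' X₀)

/-- `ρ_in = ‖s (s I - A_m)⁻¹‖_{L₁} max_{x₀ ∈ X₀} ‖x₀‖_∞`. -/
def rhoIn (X₀ : Set (Fin n → ℝ)) : ℝ≥0∞ :=
  l1Norm (lapVar • (charMat P.Am)⁻¹) * ENNReal.ofReal (initRadius X₀)

/-- `ᾱ₀(T) = ∫₀ᵀ ‖exp(A_e (T - τ)) B‖_∞ dτ`. -/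
def alpha0 : ℝ :=
  ∫ τ in (0 : ℝ)..P.T, matNorm (NormedSpace.exp ((P.T - τ) • P.Ae) * P.B)

/-- `ᾱ₁(T) = max_{t ∈ [0, T]} ‖exp(A_e t)‖_∞`. -/
def alpha1 : ℝ :=
  sSup ((fun t : ℝ => matNorm (NormedSpace.exp (t • P.Ae))) '' Set.Icc 0 P.T)

/-- `ᾱ₂(T) = max_{t ∈ [0, T]} ∫₀ᵗ ‖exp(A_e (t - τ)) Φ(T)⁻¹ exp(A_e T)‖_∞ dτ`. -/
def alpha2 : ℝ :=
  sSup ((fun t : ℝ => ∫ τ in (0 : ℝ)..t,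
    matNorm (NormedSpace.exp ((t - τ) • P.Ae) * P.Phi⁻¹ * NormedSpace.exp (P.T • P.Ae)))
      '' Set.Icc 0 P.T)

/-- `γ₀(T) = b ᾱ₀(T) (ᾱ₁(T) + ᾱ₂(T) + 1)`, where `b` is the bound on `f` over `X_a`. -/
def gamma0 (b : ℝ) : ℝ := b * P.alpha0 * (P.alpha1 + P.alpha2 + 1)

/-- `γ₂ = ‖C(s)‖_{L₁} L γ₁ + ‖C(s) B† (s I - A_e)‖_{L₁} γ₀(T)`, where `L` and `b` are the Lipschitz
constant and the bound of `f` over `X_a`. -/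
def gamma2 (L b γ₁ : ℝ) : ℝ≥0∞ :=
  l1Norm (filterTF P.k) * ENNReal.ofReal (L * γ₁)
    + l1Norm P.filterInv * ENNReal.ofReal (P.gamma0 b)

/-- The stability condition
`‖G_{xm}(s)‖_{L₁} b < ρ_r - ‖H_{xv}(s)‖_{L₁} ‖v‖_{L∞} - ρ_in`. -/
def StabCond (v : ℝ → Fin m → ℝ) (X₀ : Set (Fin n → ℝ)) (b ρr : ℝ) : Prop :=
  l1Norm P.Gxm * ENNReal.ofReal b + l1Norm P.Hxv * linfNorm v + P.rhoIn X₀ < ENNReal.ofReal ρr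

/-- The stability condition `‖G_{xm}(s)‖_{L₁} L < 1`. -/
def StabCondLip (L : ℝ) : Prop := l1Norm P.Gxm * ENNReal.ofReal L < 1

/-- The sample-time constraint
`‖H_{xm}(s) C(s) B† (s I - A_e)‖_{L₁} / (1 - ‖G_{xm}(s)‖_{L₁} L) · γ₀(T) < γ₁`. -/
def SampleCond (L b γ₁ : ℝ) : Prop :=
  l1Norm (P.Hxm * P.filterInv) / (1 - l1Norm P.Gxm * ENNReal.ofReal L)
    * ENNReal.ofReal (P.gamma0 b) < ENNReal.ofReal γ₁

/-! ### The transformed system, for a transformation matrix `S = 𝖳` -/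

/-- `Ǎ_m = 𝖳 A_m 𝖳⁻¹`. -/
def checkAm (S : Matrix (Fin n) (Fin n) ℝ) : Matrix (Fin n) (Fin n) ℝ := S * P.Am * S⁻¹

/-- `H_{x̌v}(s) = (s I - Ǎ_m)⁻¹ B̌_v` with `B̌_v = 𝖳 B_v`. -/
def checkHxv (S : Matrix (Fin n) (Fin n) ℝ) : Transfer n m :=
  stateTransfer (P.checkAm S) (S * P.Bv)

/-- `G_{x̌m}(s) = (s I - Ǎ_m)⁻¹ B̌ (I - C(s))` with `B̌ = 𝖳 B`. -/
def checkGxm (S : Matrix (Fin n) (Fin n) ℝ) : Transfer n m :=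
  filteredTransfer (P.checkAm S) (S * P.B) P.k

/-- `ρ̌_in = ‖s 𝖳 (s I - A_m)⁻¹‖_{L₁} max_{x₀ ∈ X₀} ‖x₀‖_∞`. -/
def checkRhoIn (S : Matrix (Fin n) (Fin n) ℝ) (X₀ : Set (Fin n → ℝ)) : ℝ≥0∞ :=
  l1Norm (lapVar • (gain S * (charMat P.Am)⁻¹)) * ENNReal.ofReal (initRadius X₀)

/-- The stability condition of the transformed system,
`‖G_{x̌m}(s)‖_{L₁} b̌ < ρ̌_r - ‖H_{x̌v}(s)‖_{L₁} ‖v‖_{L∞} - ρ̌_in`. -/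
def CheckStabCond (S : Matrix (Fin n) (Fin n) ℝ) (v : ℝ → Fin m → ℝ) (X₀ : Set (Fin n → ℝ))
    (b ρr : ℝ) : Prop :=
  l1Norm (P.checkGxm S) * ENNReal.ofReal b + l1Norm (P.checkHxv S) * linfNorm v
    + P.checkRhoIn S X₀ < ENNReal.ofReal ρr

/-! ### The separate bounds -/

/-- `ρ̃^i = ‖G^i_{x̌m}(s)‖_{L₁} b + γ₁`, for the transformation matrix `S` of index `i`. -/
def rhoTilde (S : Matrix (Fin n) (Fin n) ℝ) (b γ₁ : ℝ) : ℝ≥0∞ :=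
  l1Norm (P.checkGxm S) * ENNReal.ofReal b + ENNReal.ofReal γ₁

/-- `ρ_{u_a}^j = ‖C_j(s)‖_{L₁} b_j + γ₂`. -/
def rhoUa (j : Fin m) (bj : ℝ) (γ₂ : ℝ≥0∞) : ℝ≥0∞ :=
  l1Norm (filterEntry (P.k j)) * ENNReal.ofReal bj + γ₂

end Params

end L1Adaptive

end

open L1Adaptive

/-! The adaptive loop is compared with a reference system in which the filter acts on the true
uncertainty: `x_r = x_n + z`, `ż = A_m z + B (φ - w)`, where `φ = f(t, x_r)` and `w = C(s) φ`. Each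
bound splits into reference minus nominal, namely `z` for the state and `-w` for the adaptive input,
and adaptive minus reference.

Reference part (`exists_reference`, `scaled_reference_bound`). The signal `z` is the response of
`G_xm` to `φ`. With `f` cut off outside `Ω(ρ_r)` the system is solvable and `φ` is bounded in
advance, so the first stability condition puts `x_r` in `Ω(ρ_r)` and the cut-off is never active.
The same estimate in the coordinates `𝖳^i` bounds the `i`-th component of `x_r` by `ρ̌_r^i`. Hence
`x_r` stays in the box, and the bounds of `f` on the box yield the final estimates of `z` and `w`.

Deviation part (`error_decomposition`, `deviation_bound`). Applying `B†` to the prediction-error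
equation gives `B† (s I - A_e) x̃ = σ̂₁ - f`. Hence `x - x_r = G_xm δ - H_xm C B† (s I - A_e) x̃`
with `δ = f(t, x) - φ`, and similarly for the input. The adaptive law makes `x̃` at the end of each
period independent of its value at the start, so errors do not accumulate and `‖x̃‖ ≤ γ₀(T)` while
`x` is in `X_a` (`Params.norm_predictionError_le`). While `‖x - x_r‖ ≤ γ₁`, the state is in `X_a`,
`δ` is controlled by the Lipschitz constant there, and the small-gain and sample-time conditions
give `‖x - x_r‖ < γ₁`. Continuity removes the proviso (`le_of_forall_prefix`).

Transfer-matrix relations are used in the time domain: a `Response` is a trajectory of some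
realization, so each relation is proved by exhibiting one. `Response.norm_le` then reduces to the
definition of the `L₁` norm by truncating and rescaling the input. -/

open Set Filter Topology intervalIntegral
open scoped Matrix.Norms.Operator NNReal

/-! ### Integral trajectories -/

/-- `x` solves `ẋ = g`, `x(0) = x₀` in the integral sense on `[0, τ]`. -/
def TrajOn {E : Type*} [NormedAddCommGroup E] [NormedSpace ℝ E] (τ : ℝ) (x₀ : E) (x g : ℝ → E) :
    Prop :=
  ∀ t ∈ Icc 0 τ, IntervalIntegrable g volume 0 t ∧ x t = x₀ + ∫ s in (0 : ℝ)..t, g s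

namespace TrajOn

variable {E F : Type*} [NormedAddCommGroup E] [NormedSpace ℝ E] [NormedAddCommGroup F]
  [NormedSpace ℝ F] {τ : ℝ} {x₀ y₀ : E} {x y g h : ℝ → E}

theorem init (H : TrajOn τ x₀ x g) (hτ : 0 ≤ τ) : x 0 = x₀ := by
  simpa using (H 0 ⟨le_rfl, hτ⟩).2

theorem mono (H : TrajOn τ x₀ x g) {σ : ℝ} (hσ : σ ≤ τ) : TrajOn σ x₀ x g :=
  fun t ht => H t ⟨ht.1, ht.2.trans hσ⟩

theorem continuousOn (H : TrajOn τ x₀ x g) : ContinuousOn x (Icc 0 τ) := by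
  rcases le_or_gt 0 τ with hτ | hτ
  · have h1 : ContinuousOn (fun t => x₀ + ∫ s in (0 : ℝ)..t, g s) (Icc 0 τ) := by
      refine continuousOn_const.add ?_
      have := continuousOn_primitive_interval' (H τ ⟨hτ, le_rfl⟩).1 left_mem_uIcc
      rwa [uIcc_of_le hτ] at this
    exact h1.congr fun t ht => (H t ht).2
  · simp [Icc_eq_empty (not_le.mpr hτ)]

theorem congr (H : TrajOn τ x₀ x g) (hx : ∀ t ∈ Icc 0 τ, y t = x t)
    (hg : ∀ t ∈ Icc 0 τ, h t = g t) : TrajOn τ x₀ y h := by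
  intro t ht
  have h1 : ∀ s ∈ Set.uIcc 0 t, g s = h s := by
    intro s hs
    rw [uIcc_of_le ht.1] at hs
    exact (hg s ⟨hs.1, hs.2.trans ht.2⟩).symm
  refine ⟨(H t ht).1.congr fun s hs => h1 s (uIoc_subset_uIcc hs), ?_⟩
  rw [hx t ht, (H t ht).2, integral_congr h1]

theorem add (H : TrajOn τ x₀ x g) (K : TrajOn τ y₀ y h) :
    TrajOn τ (x₀ + y₀) (fun t => x t + y t) (fun t => g t + h t) := by
  intro t ht
  refine ⟨(H t ht).1.add (K t ht).1, ?_⟩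
  simp only
  rw [integral_add (H t ht).1 (K t ht).1, (H t ht).2, (K t ht).2]
  abel

theorem sub (H : TrajOn τ x₀ x g) (K : TrajOn τ y₀ y h) :
    TrajOn τ (x₀ - y₀) (fun t => x t - y t) (fun t => g t - h t) := by
  intro t ht
  refine ⟨(H t ht).1.sub (K t ht).1, ?_⟩
  simp only
  rw [integral_sub (H t ht).1 (K t ht).1, (H t ht).2, (K t ht).2]
  abel

theorem map [CompleteSpace E] [CompleteSpace F] (H : TrajOn τ x₀ x g) (T : E →L[ℝ] F) :
    TrajOn τ (T x₀) (fun t => T (x t)) (fun t => T (g t)) := by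
  intro t ht
  refine ⟨⟨T.integrable_comp (H t ht).1.1, T.integrable_comp (H t ht).1.2⟩, ?_⟩
  simp only
  rw [T.intervalIntegral_comp_comm (H t ht).1, (H t ht).2, map_add]

theorem hasDerivWithinAt [CompleteSpace E] (H : TrajOn τ x₀ x g)
    (hg : ContinuousOn g (Icc 0 τ)) {t : ℝ}
    (ht : t ∈ Icc 0 τ) : HasDerivWithinAt x (g t) (Icc 0 τ) t := by
  have h1 : HasDerivWithinAt (fun t => ∫ s in (0 : ℝ)..t, g s) (g t) (Icc 0 τ) t := by
    have : Fact (t ∈ Icc 0 τ) := ⟨ht⟩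
    exact integral_hasDerivWithinAt_right (H t ht).1
      (hg.stronglyMeasurableAtFilter_nhdsWithin measurableSet_Icc t) (hg t ht)
  exact (h1.const_add x₀).congr (fun s hs => (H s hs).2) (H t ht).2

theorem hasDerivWithinAt_Ici [CompleteSpace E] (H : TrajOn τ x₀ x g)
    (hg : ContinuousOn g (Icc 0 τ)) {t : ℝ}
    (ht : t ∈ Ico 0 τ) : HasDerivWithinAt x (g t) (Ici t) t :=
  ((H.hasDerivWithinAt hg (Ico_subset_Icc_self ht)).mono
    (Icc_subset_Icc_left ht.1)).mono_of_mem_nhdsWithin (Icc_mem_nhdsGE ht.2)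

theorem of_hasDerivWithinAt [CompleteSpace E] (hg : ContinuousOn g (Icc 0 τ))
    (hx : ∀ t ∈ Icc 0 τ, HasDerivWithinAt x (g t) (Icc 0 τ) t) (h0 : x 0 = x₀) :
    TrajOn τ x₀ x g := by
  intro t ht
  have hsub : Icc 0 t ⊆ Icc 0 τ := Icc_subset_Icc_right ht.2
  have hint : IntervalIntegrable g volume 0 t :=
    (hg.mono hsub).intervalIntegrable_of_Icc ht.1
  refine ⟨hint, ?_⟩
  rw [integral_eq_sub_of_hasDeriv_right_of_le ht.1
    (fun s hs => ((hx s (hsub hs)).continuousWithinAt).mono hsub)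
    (fun s hs => ?_) hint, h0]
  · abel
  · have hs' : s ∈ Icc 0 τ := hsub (Ioo_subset_Icc_self hs)
    exact (((hx s hs').mono (Icc_subset_Icc_left hs'.1)).mono_of_mem_nhdsWithin
      (Icc_mem_nhdsGE (hs.2.trans_le ht.2))).mono Ioi_subset_Ici_self

/-- A solution of a linear homogeneous equation with zero initial value vanishes. -/
theorem eq_zero [CompleteSpace E] {A : E →L[ℝ] E} (H : TrajOn τ 0 x (fun t => A (x t))) :
    ∀ t ∈ Icc 0 τ, x t = 0 := by
  have hc : ContinuousOn (fun t => A (x t)) (Icc 0 τ) :=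
    A.continuous.comp_continuousOn H.continuousOn
  intro t ht
  exact eq_zero_of_abs_deriv_le_mul_abs_self_of_eq_zero_right H.continuousOn
    (fun s hs => H.hasDerivWithinAt_Ici hc hs) (H.init (ht.1.trans ht.2))
    (fun s _ => A.le_opNorm (x s)) t ht

/-- Solutions of linear equations are determined by their forcing term and initial value. -/
theorem linear_unique [CompleteSpace E] {A : E →L[ℝ] E} {f : ℝ → E}
    (H : TrajOn τ x₀ x (fun t => A (x t) + f t)) (K : TrajOn τ x₀ y (fun t => A (y t) + f t)) :
    ∀ t ∈ Icc 0 τ, x t = y t := by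
  have h1 : TrajOn τ 0 (fun t => x t - y t) (fun t => A (x t - y t)) := by
    have := H.sub K
    simp only [sub_self] at this
    exact this.congr (fun _ _ => rfl) (fun t _ => by rw [map_sub]; abel)
  exact fun t ht => sub_eq_zero.mp (h1.eq_zero t ht)

end TrajOn

/-! ### Matrices acting on vectors -/

section

variable {ι κ : Type*} [Fintype ι]

/-- A real matrix as a continuous linear map. -/
noncomputable def mulVecCLM (M : Matrix κ ι ℝ) : (ι → ℝ) →L[ℝ] (κ → ℝ) :=
  LinearMap.toContinuousLinearMap M.mulVecLin

@[simp] theorem mulVecCLM_apply (M : Matrix κ ι ℝ) (v : ι → ℝ) : mulVecCLM M v = M *ᵥ v := rfl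

theorem ContinuousOn.mulVec_const {M : Matrix κ ι ℝ} {x : ℝ → ι → ℝ} {s : Set ℝ}
    (hx : ContinuousOn x s) : ContinuousOn (fun t => M *ᵥ x t) s :=
  (mulVecCLM M).continuous.comp_continuousOn hx

theorem HasDerivWithinAt.mulVec [DecidableEq ι] {M : ℝ → Matrix ι ι ℝ} {M' : Matrix ι ι ℝ}
    {x : ℝ → ι → ℝ} {x' : ι → ℝ} {s : Set ℝ} {t : ℝ}
    (hM : HasDerivWithinAt M M' s t) (hx : HasDerivWithinAt x x' s t) :
    HasDerivWithinAt (fun t => M t *ᵥ x t) (M' *ᵥ x t + M t *ᵥ x') s t := by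
  rw [hasDerivWithinAt_pi]
  intro i
  have h1 : ∀ j, HasDerivWithinAt (fun t => M t i j) (M' i j) s t := fun j =>
    (LinearMap.toContinuousLinearMap
      (Matrix.entryLinearMap ℝ ℝ i j)).hasFDerivAt.comp_hasDerivWithinAt t hM
  have h2 := HasDerivWithinAt.fun_sum (u := Finset.univ)
    fun j _ => (h1 j).mul (hasDerivWithinAt_pi.mp hx j)
  simpa [Matrix.mulVec, dotProduct, Finset.sum_add_distrib] using h2

theorem hasDerivAt_exp_smul [DecidableEq ι] (A : Matrix ι ι ℝ) (t : ℝ) :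
    HasDerivAt (fun t : ℝ => NormedSpace.exp (t • A)) (A * NormedSpace.exp (t • A)) t :=
  hasDerivAt_exp_smul_const' A t

theorem continuous_exp_smul [DecidableEq ι] (A : Matrix ι ι ℝ) :
    Continuous (fun t : ℝ => NormedSpace.exp (t • A)) :=
  continuous_iff_continuousAt.mpr fun t => (hasDerivAt_exp_smul A t).continuousAt

theorem exp_smul_neg_mul [DecidableEq ι] (A : Matrix ι ι ℝ) (t : ℝ) :
    NormedSpace.exp (t • A) * NormedSpace.exp ((-t) • A) = 1 := by
  rw [← Matrix.exp_add_of_commute _ _ ((Commute.refl A).smul_left t |>.smul_right _), ← add_smul]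
  simp

theorem exp_smul_add [DecidableEq ι] (A : Matrix ι ι ℝ) (s t : ℝ) :
    NormedSpace.exp ((s + t) • A) = NormedSpace.exp (s • A) * NormedSpace.exp (t • A) := by
  rw [add_smul, Matrix.exp_add_of_commute _ _ ((Commute.refl A).smul_left s |>.smul_right _)]

/-- The factor `A` is kept on the right, where it meets `x` in the product rule for `exp(-tA) x`. -/
theorem hasDerivAt_exp_neg_smul [DecidableEq ι] (A : Matrix ι ι ℝ) (t : ℝ) :
    HasDerivAt (fun t : ℝ => NormedSpace.exp ((-t) • A)) (-(NormedSpace.exp ((-t) • A) * A)) t := by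
  have := (hasDerivAt_exp_smul_const A (-t)).scomp t (hasDerivAt_neg t)
  exact this.congr_deriv (neg_one_smul ℝ _)

/-- Variation of constants. -/
theorem TrajOn.variation_of_constants [DecidableEq ι] {A : Matrix ι ι ℝ} {τ : ℝ} {x₀ : ι → ℝ}
    {x f : ℝ → ι → ℝ} (H : TrajOn τ x₀ x (fun t => A *ᵥ x t + f t))
    (hf : ContinuousOn f (Icc 0 τ)) {t : ℝ} (ht : t ∈ Icc 0 τ) :
    x t = NormedSpace.exp (t • A) *ᵥ x₀
      + ∫ s in (0 : ℝ)..t, NormedSpace.exp ((t - s) • A) *ᵥ f s := by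
  have hgc : ContinuousOn (fun t => A *ᵥ x t + f t) (Icc 0 τ) :=
    H.continuousOn.mulVec_const.add hf
  have h0 : x 0 = x₀ := H.init (ht.1.trans ht.2)
  have hE : ∀ s, HasDerivAt (fun t : ℝ => NormedSpace.exp ((-t) • A))
    (-(NormedSpace.exp ((-s) • A) * A)) s := hasDerivAt_exp_neg_smul A
  have hEc : Continuous (fun t : ℝ => NormedSpace.exp ((-t) • A)) :=
    continuous_iff_continuousAt.mpr fun s => (hE s).continuousAt
  -- Integrating factor: the two terms containing `A` cancel in the derivative of `exp(-tA) x(t)`.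
  have hd : ∀ s ∈ Icc 0 τ, HasDerivWithinAt (fun t : ℝ => NormedSpace.exp ((-t) • A) *ᵥ x t)
      (NormedSpace.exp ((-s) • A) *ᵥ f s) (Icc 0 τ) s := by
    intro s hs
    have h1 := (hE s).hasDerivWithinAt.mulVec (H.hasDerivWithinAt hgc hs)
    refine h1.congr_deriv ?_
    rw [Matrix.mulVec_add, Matrix.neg_mulVec, Matrix.mulVec_mulVec]
    abel
  have hfc : ContinuousOn (fun s => NormedSpace.exp ((-s) • A) *ᵥ f s) (Icc 0 τ) := by
    refine ContinuousOn.congr (f := fun s => (fun i => ∑ j, NormedSpace.exp ((-s) • A) i j * f s j))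
      ?_ (fun s _ => rfl)
    refine continuousOn_pi.mpr fun i => continuousOn_finsetSum _ fun j _ => ?_
    exact ((hEc.matrix_elem i j).continuousOn).mul (continuousOn_pi.mp hf j)
  have h2 := (TrajOn.of_hasDerivWithinAt hfc hd rfl t ht).2
  simp only [h0, neg_zero, zero_smul, NormedSpace.exp_zero, Matrix.one_mulVec] at h2
  have h3 : x t = NormedSpace.exp (t • A) *ᵥ (NormedSpace.exp ((-t) • A) *ᵥ x t) := by
    rw [Matrix.mulVec_mulVec, exp_smul_neg_mul, Matrix.one_mulVec]
  rw [h3, h2, Matrix.mulVec_add]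
  congr 1
  refine ((mulVecCLM (NormedSpace.exp (t • A))).intervalIntegral_comp_comm
    ((hfc.mono (Icc_subset_Icc_right ht.2)).intervalIntegrable_of_Icc ht.1)).symm.trans ?_
  refine integral_congr fun s _ => ?_
  simp only [mulVecCLM_apply]
  rw [Matrix.mulVec_mulVec, sub_eq_add_neg, exp_smul_add]

/-- Linear equations with locally integrable forcing have a solution on `[0, ∞)`. -/
theorem exists_linear_traj [DecidableEq ι] (A : Matrix ι ι ℝ) (x₀ : ι → ℝ) {f : ℝ → ι → ℝ}
    (hf : ∀ t, 0 ≤ t → IntervalIntegrable f volume 0 t) :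
    ∃ x : ℝ → ι → ℝ, ∀ τ, TrajOn τ x₀ x (fun t => A *ᵥ x t + f t) := by
  -- Since `f` is only integrable, its primitive `y` is split off: the remainder `z = x - y` has the
  -- continuous forcing `A y`, so it is differentiable and given by variation of constants. The
  -- argument `max t 0` extends `y` continuously to negative times.
  set y : ℝ → ι → ℝ := fun t => ∫ s in (0 : ℝ)..t, f s with hy
  have hyT : ∀ τ, TrajOn τ 0 y f := fun τ t ht => ⟨hf t ht.1, by simp [hy]⟩
  have hyc : Continuous (fun t => y (max t 0)) := by
    have h1 : ContinuousOn y (Ici 0) := by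
      intro t ht
      have := (hyT (t + 1)).continuousOn t ⟨ht, by linarith⟩
      refine this.mono_of_mem_nhdsWithin ?_
      have h2 : Iic (t + 1) ∈ 𝓝[Ici 0] t := mem_nhdsWithin_of_mem_nhds (Iic_mem_nhds (by linarith))
      filter_upwards [h2, self_mem_nhdsWithin] with s h3 h4 using ⟨h4, h3⟩
    exact h1.comp_continuous (by fun_prop) fun t => mem_Ici.mpr (le_max_right _ _)
  set q : ℝ → ι → ℝ := fun s => NormedSpace.exp ((-s) • A) *ᵥ (A *ᵥ y (max s 0)) with hq
  have hqc : Continuous q := by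
    have hEc : Continuous (fun t : ℝ => NormedSpace.exp ((-t) • A)) :=
      continuous_iff_continuousAt.mpr fun s => (hasDerivAt_exp_neg_smul A s).continuousAt
    refine continuous_pi fun i => continuous_finsetSum _ fun j _ => ?_
    exact (hEc.matrix_elem i j).mul
      ((continuous_apply j).comp ((mulVecCLM A).continuous.comp hyc))
  set z : ℝ → ι → ℝ := fun t => NormedSpace.exp (t • A) *ᵥ (x₀ + ∫ s in (0 : ℝ)..t, q s) with hz
  have hzd : ∀ t, HasDerivAt z (A *ᵥ z t + A *ᵥ y (max t 0)) t := by
    intro t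
    have h1 : HasDerivAt (fun t => x₀ + ∫ s in (0 : ℝ)..t, q s) (q t) t :=
      (integral_hasDerivAt_right (hqc.intervalIntegrable _ _)
        hqc.aestronglyMeasurable.stronglyMeasurableAtFilter hqc.continuousAt).const_add x₀
    have h2 := (hasDerivAt_exp_smul A t).hasDerivWithinAt.mulVec (s := univ) h1.hasDerivWithinAt
    rw [hasDerivWithinAt_univ] at h2
    refine h2.congr_deriv ?_
    simp only [hq, hz]
    simp only [Matrix.mulVec_mulVec, ← Matrix.mul_assoc, exp_smul_neg_mul, Matrix.one_mul]
  have hzc : Continuous z := continuous_iff_continuousAt.mpr fun t => (hzd t).continuousAt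
  refine ⟨fun t => z t + y t, fun τ => ?_⟩
  have hzT : TrajOn τ x₀ z (fun t => A *ᵥ z t + A *ᵥ y (max t 0)) := by
    refine TrajOn.of_hasDerivWithinAt ?_ (fun t _ => (hzd t).hasDerivWithinAt) (by simp [hz])
    exact (((mulVecCLM A).continuous.comp hzc).add ((mulVecCLM A).continuous.comp hyc)).continuousOn
  have := hzT.add (hyT τ)
  rw [add_zero] at this
  refine this.congr (fun _ _ => rfl) fun t ht => ?_
  simp only [max_eq_left ht.1, Matrix.mulVec_add]

end

theorem ContinuousOn.matrix_mulVec {ι κ : Type*} [Fintype κ] {M : ℝ → Matrix ι κ ℝ}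
    {x : ℝ → κ → ℝ} {s : Set ℝ} (hM : ContinuousOn M s) (hx : ContinuousOn x s) :
    ContinuousOn (fun t => M t *ᵥ x t) s := by
  refine continuousOn_pi.mpr fun i => continuousOn_finsetSum _ fun j _ => ?_
  have h1 : Continuous fun N : Matrix ι κ ℝ => N i j := continuous_id.matrix_elem i j
  exact (h1.comp_continuousOn hM).mul (continuousOn_pi.mp hx j)

/-- A linear system in feedback with a bounded, Lipschitz nonlinearity `g` has a solution on
`[0, τ]`; `φ` is the signal fed back. -/
theorem exists_semilinear_traj {ι κ μ : Type*} [Fintype ι] [DecidableEq ι] [Fintype κ] [Fintype μ]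
    (A : Matrix ι ι ℝ) (B : Matrix ι κ ℝ) (C : Matrix μ ι ℝ) {g : ℝ → (μ → ℝ) → κ → ℝ}
    {τ : ℝ} (hτ : 0 ≤ τ) (M K : ℝ≥0) (hb : ∀ s ∈ Icc 0 τ, ∀ z, ‖g s z‖ ≤ M)
    (hl : ∀ s ∈ Icc 0 τ, LipschitzWith K (g s))
    (hc : ∀ z, ContinuousOn (fun s => g s z) (Icc 0 τ)) :
    ∃ (Z : ℝ → ι → ℝ) (φ : ℝ → κ → ℝ), TrajOn τ 0 Z (fun t => A *ᵥ Z t + B *ᵥ φ t) ∧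
      ContinuousOn φ (Icc 0 τ) ∧ ∀ s ∈ Icc 0 τ, φ s = g s (C *ᵥ Z s) := by
  have hgc : ∀ {w : ℝ → μ → ℝ}, ContinuousOn w (Icc 0 τ) →
      ContinuousOn (fun s => g s (w s)) (Icc 0 τ) := by
    intro w hw
    have h1 : ContinuousOn (Function.uncurry g) (Icc 0 τ ×ˢ univ) :=
      continuousOn_prod_of_continuousOn_lipschitzOnWith' _ K (fun s hs => (hl s hs).lipschitzOnWith)
        (fun z _ => hc z)
    exact h1.comp (continuousOn_id.prodMk hw) fun s hs => ⟨hs, mem_univ _⟩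
  set U : ℝ → Matrix ι ι ℝ := fun t => NormedSpace.exp (t • A) with hU
  have hUc : Continuous U := continuous_exp_smul A
  have hVc : Continuous (fun t => U (-t)) := hUc.comp continuous_neg
  have hbd : ∀ {V : ℝ → Matrix ι ι ℝ}, Continuous V → ∃ E : ℝ≥0, ∀ s ∈ Icc 0 τ, ‖V s‖ ≤ E := by
    intro V hV
    obtain ⟨E, hE⟩ := isCompact_Icc.exists_bound_of_continuousOn (s := Icc 0 τ) hV.continuousOn
    exact ⟨E.toNNReal, fun s hs => (hE s hs).trans (Real.le_coe_toNNReal E)⟩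
  obtain ⟨E₁, hE₁⟩ := hbd hUc
  obtain ⟨E₂, hE₂⟩ := hbd hVc
  -- In the variable `ζ = exp(-sA) Z` the linear term disappears and the vector field is bounded
  -- independently of `ζ`. A ball of radius bound times `τ` therefore suffices for Picard–Lindelöf
  -- on all of `[0, τ]`, with no smallness condition.
  set F : ℝ → (ι → ℝ) → ι → ℝ := fun s ζ => U (-s) *ᵥ (B *ᵥ g s (C *ᵥ (U s *ᵥ ζ))) with hF
  have hpl : IsPicardLindelof F (tmin := 0) (tmax := τ) ⟨0, le_rfl, hτ⟩ (0 : ι → ℝ)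
      (E₂ * (‖B‖₊ * M) * τ.toNNReal) 0 (E₂ * (‖B‖₊ * M)) (E₂ * (‖B‖₊ * (K * (‖C‖₊ * E₁)))) := by
    refine ⟨fun s hs => LipschitzWith.lipschitzOnWith ?_, fun ζ _ => ?_, fun s hs ζ _ => ?_, ?_⟩
    · refine LipschitzWith.of_dist_le_mul fun ζ ξ => ?_
      simp only [hF, dist_eq_norm, ← Matrix.mulVec_sub]
      push_cast
      calc _ ≤ ‖U (-s)‖ * (‖B‖ * ‖g s (C *ᵥ (U s *ᵥ ζ)) - g s (C *ᵥ (U s *ᵥ ξ))‖) :=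
            (linfty_opNorm_mulVec _ _).trans (by gcongr; exact linfty_opNorm_mulVec _ _)
        _ ≤ E₂ * (‖B‖ * (K * (‖C‖ * (E₁ * ‖ζ - ξ‖)))) := by
            gcongr
            · exact hE₂ s hs
            · have h1 := (hl s hs).dist_le_mul (C *ᵥ (U s *ᵥ ζ)) (C *ᵥ (U s *ᵥ ξ))
              simp only [dist_eq_norm, ← Matrix.mulVec_sub] at h1
              refine h1.trans ?_
              gcongr
              refine (linfty_opNorm_mulVec _ _).trans ?_
              gcongr
              refine (linfty_opNorm_mulVec _ _).trans ?_
              gcongr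
              exact hE₁ s hs
        _ = _ := by ring
    · refine hVc.continuousOn.matrix_mulVec (ContinuousOn.mulVec_const (hgc ?_))
      exact (hUc.continuousOn.matrix_mulVec continuousOn_const).mulVec_const
    · push_cast
      refine (linfty_opNorm_mulVec _ _).trans ?_
      gcongr
      · exact hE₂ s hs
      · refine (linfty_opNorm_mulVec _ _).trans ?_
        gcongr
        exact hb s hs _
    · simp [hτ]
  obtain ⟨ζ, hζ0, hζ⟩ := hpl.exists_eq_forall_mem_Icc_hasDerivWithinAt₀
  have hζc : ContinuousOn ζ (Icc 0 τ) := fun t ht => (hζ t ht).continuousWithinAt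
  have hZc : ContinuousOn (fun t => U t *ᵥ ζ t) (Icc 0 τ) := hUc.continuousOn.matrix_mulVec hζc
  refine ⟨fun t => U t *ᵥ ζ t, fun s => g s (C *ᵥ (U s *ᵥ ζ s)), ?_, hgc hZc.mulVec_const,
    fun _ _ => rfl⟩
  refine TrajOn.of_hasDerivWithinAt
    (hZc.mulVec_const.add (hgc hZc.mulVec_const).mulVec_const) (fun t ht => ?_) ?_
  · refine ((hasDerivAt_exp_smul A t).hasDerivWithinAt.mulVec (hζ t ht)).congr_deriv ?_
    simp only [hF, hU]
    rw [Matrix.mulVec_mulVec, exp_smul_neg_mul, Matrix.one_mulVec, ← Matrix.mulVec_mulVec]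
  · have : ζ 0 = 0 := hζ0
    simp [this]

theorem intervalIntegrable_indicator_Icc {E : Type*} [NormedAddCommGroup E] {φ : ℝ → E} {τ : ℝ}
    (hφ : ContinuousOn φ (Icc 0 τ)) (t : ℝ) :
    IntervalIntegrable ((Icc 0 τ).indicator φ) volume 0 t :=
  ((integrable_indicator_iff measurableSet_Icc).mpr
    (hφ.integrableOn_compact isCompact_Icc)).intervalIntegrable

/-- The `L₁` norm admits only measurable inputs on the whole line, whereas the signals below are
known to be continuous on `[0, τ]` only. -/
theorem measurable_indicator_Icc {κ : Type*} [Fintype κ] {φ : ℝ → κ → ℝ} {τ : ℝ}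
    (hφ : ContinuousOn φ (Icc 0 τ)) : Measurable ((Icc 0 τ).indicator φ) := by
  classical
  rw [← Set.piecewise_eq_indicator]
  exact hφ.measurable_piecewise continuousOn_const measurableSet_Icc

/-- The signal fed back in `exists_semilinear_traj`, cut off at `τ`, together with the response to
it on `[0, ∞)`. -/
theorem exists_semilinear_response {ι κ μ : Type*} [Fintype ι] [DecidableEq ι] [Fintype κ]
    [Fintype μ] (A : Matrix ι ι ℝ) (B : Matrix ι κ ℝ) (C : Matrix μ ι ℝ)
    {g : ℝ → (μ → ℝ) → κ → ℝ}
    {τ : ℝ} (hτ : 0 ≤ τ) (M K : ℝ≥0) (hb : ∀ s ∈ Icc 0 τ, ∀ z, ‖g s z‖ ≤ M)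
    (hl : ∀ s ∈ Icc 0 τ, LipschitzWith K (g s))
    (hc : ∀ z, ContinuousOn (fun s => g s z) (Icc 0 τ)) :
    ∃ (Z : ℝ → ι → ℝ) (φ : ℝ → κ → ℝ), (∀ σ, TrajOn σ 0 Z (fun t => A *ᵥ Z t + B *ᵥ φ t)) ∧
      (∀ t, IntervalIntegrable φ volume 0 t) ∧ ContinuousOn φ (Icc 0 τ) ∧
      ∀ s ∈ Icc 0 τ, φ s = g s (C *ᵥ Z s) := by
  obtain ⟨Z, φ, hZ, hφ, hφg⟩ := exists_semilinear_traj A B C hτ M K hb hl hc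
  -- Nothing is known of `φ` beyond `τ`. Replacing it there by zero makes the forcing integrable,
  -- and uniqueness keeps the trajectory unchanged on `[0, τ]`.
  have hφi := intervalIntegrable_indicator_Icc hφ
  obtain ⟨Y, hY⟩ := exists_linear_traj A 0 (f := fun t => B *ᵥ (Icc 0 τ).indicator φ t)
    (fun t _ => ⟨(mulVecCLM B).integrable_comp (hφi t).1, (mulVecCLM B).integrable_comp (hφi t).2⟩)
  have heq : ∀ s ∈ Icc 0 τ, Y s = Z s := by
    refine TrajOn.linear_unique (A := mulVecCLM A) (hY τ) (hZ.congr (fun _ _ => rfl) fun t ht => ?_)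
    simp [ht]
  refine ⟨Y, _, hY, hφi, hφ.congr fun s hs => indicator_of_mem hs φ, fun s hs => ?_⟩
  rw [indicator_of_mem hs, hφg s hs, heq s hs]

/-! ### Zero-state responses of transfer matrices -/

theorem solvesFrom_iff {n : ℕ} {x₀ : Fin n → ℝ} {x g : ℝ → Fin n → ℝ} :
    SolvesFrom x₀ x g ↔ ∀ τ, TrajOn τ x₀ x g :=
  ⟨fun H _ t ht => H t ht.1, fun H t ht => H t t ⟨ht, le_rfl⟩⟩

theorem TrajOn.congr' {E : Type*} [NormedAddCommGroup E] [NormedSpace ℝ E] {τ : ℝ} {x₀ y₀ : E}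
    {x y g h : ℝ → E} (H : TrajOn τ x₀ x g) (h0 : y₀ = x₀) (hx : ∀ t ∈ Icc 0 τ, y t = x t)
    (hg : ∀ t ∈ Icc 0 τ, h t = g t) : TrajOn τ y₀ y h :=
  h0 ▸ H.congr hx hg

theorem TrajOn.sumElim {ι κ : Type*} [Fintype ι] [Fintype κ] {τ : ℝ} {x₀ : ι → ℝ} {y₀ : κ → ℝ}
    {x g : ℝ → ι → ℝ} {y h : ℝ → κ → ℝ} (H : TrajOn τ x₀ x g) (K : TrajOn τ y₀ y h) :
    TrajOn τ (Sum.elim x₀ y₀) (fun t => Sum.elim (x t) (y t))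
      (fun t => Sum.elim (g t) (h t)) := by
  classical
  have key : ∀ (a : ι → ℝ) (b : κ → ℝ), Sum.elim a b
      = mulVecCLM (Matrix.fromRows (1 : Matrix ι ι ℝ) (0 : Matrix κ ι ℝ)) a
        + mulVecCLM (Matrix.fromRows (0 : Matrix ι κ ℝ) (1 : Matrix κ κ ℝ)) b := by
    intro a b
    ext i
    rcases i with i | i <;> simp [Matrix.fromRows_mulVec]
  exact ((H.map (mulVecCLM _)).add (K.map (mulVecCLM _))).congr' (key _ _)
    (fun _ _ => key _ _) fun _ _ => key _ _

/-- `y` is the response of the system with transfer matrix `H`, from zero initial state, to the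
input `u`. -/
def Response {p q : ℕ} (H : Transfer p q) (u : ℝ → Fin q → ℝ) (y : ℝ → Fin p → ℝ) : Prop :=
  ∃ (N : ℕ) (A : Matrix (Fin N) (Fin N) ℝ) (B : Matrix (Fin N) (Fin q) ℝ)
    (C : Matrix (Fin p) (Fin N) ℝ) (D : Matrix (Fin p) (Fin q) ℝ) (x : ℝ → Fin N → ℝ),
    IsRealization A B C D H ∧ SolvesFrom 0 x (fun t => A *ᵥ x t + B *ᵥ u t) ∧
      ∀ t, 0 ≤ t → y t = C *ᵥ x t + D *ᵥ u t

theorem Response.congr_transfer {p q : ℕ} {H H' : Transfer p q} {u : ℝ → Fin q → ℝ}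
    {y : ℝ → Fin p → ℝ} (h : Response H u y) (hH : H = H') : Response H' u y := hH ▸ h

/-- The determinant is the characteristic polynomial, which is monic and hence a nonzero rational
function; no stability is involved. -/
theorem isUnit_det_charMat {n : ℕ} (A : Matrix (Fin n) (Fin n) ℝ) : IsUnit (charMat A).det := by
  have h : charMat A = (Matrix.charmatrix A).map (algebraMap (Polynomial ℝ) (RatFunc ℝ)) := by
    ext i j
    by_cases hij : i = j
    · subst hij
      simp [charMat, gain, Matrix.charmatrix]
    · simp [charMat, gain, Matrix.charmatrix, hij]
  rw [h, ← RingHom.mapMatrix_apply, ← RingHom.map_det, isUnit_iff_ne_zero, ne_eq,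
    map_eq_zero_iff _ (RatFunc.algebraMap_injective ℝ)]
  exact (Matrix.charpoly_monic A).ne_zero

theorem charMat_inv_mul_eq {n q : ℕ} {A : Matrix (Fin n) (Fin n) ℝ} {X Y : Transfer n q}
    (h : charMat A * X = Y) : (charMat A)⁻¹ * Y = X := by
  rw [← h, ← Matrix.mul_assoc, Matrix.nonsing_inv_mul _ (isUnit_det_charMat A), Matrix.one_mul]

theorem charMat_mul_inv {n : ℕ} (A : Matrix (Fin n) (Fin n) ℝ) : charMat A * (charMat A)⁻¹ = 1 :=
  Matrix.mul_nonsing_inv _ (isUnit_det_charMat A)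

/-- A response may be given by a realization with any finite index type of states, where
`X(s) = (s I - A)⁻¹ B`. -/
theorem Response.of_fintype {ι : Type*} [Fintype ι] [DecidableEq ι] {p q : ℕ} {H : Transfer p q}
    (A : Matrix ι ι ℝ) (B : Matrix ι (Fin q) ℝ) (C : Matrix (Fin p) ι ℝ)
    (D : Matrix (Fin p) (Fin q) ℝ) (X : Matrix ι (Fin q) (RatFunc ℝ))
    (hX : (lapVar • (1 : Matrix ι ι (RatFunc ℝ)) - A.map RatFunc.C) * X = B.map RatFunc.C)
    (hH : H = C.map RatFunc.C * X + gain D) {x : ℝ → ι → ℝ} {u : ℝ → Fin q → ℝ}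
    {y : ℝ → Fin p → ℝ} (hx : ∀ τ, TrajOn τ 0 x (fun t => A *ᵥ x t + B *ᵥ u t))
    (hy : ∀ t, 0 ≤ t → y t = C *ᵥ x t + D *ᵥ u t) : Response H u y := by
  set e := Fintype.equivFin ι
  refine ⟨Fintype.card ι, A.submatrix e.symm e.symm, B.submatrix e.symm id, C.submatrix id e.symm,
    D, fun t => x t ∘ e.symm, ?_, ?_, fun t ht => ?_⟩
  · have h1 : charMat (A.submatrix e.symm e.symm) * X.submatrix e.symm id
        = gain (B.submatrix e.symm id) := by
      have h2 : charMat (A.submatrix e.symm e.symm)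
          = (lapVar • (1 : Matrix ι ι (RatFunc ℝ)) - A.map RatFunc.C).submatrix e.symm e.symm := by
        ext i j
        simp [charMat, gain, Matrix.one_apply]
      rw [h2, Matrix.submatrix_mul_equiv, hX]
      rfl
    have h3 : gain (C.submatrix id e.symm) = (C.map RatFunc.C).submatrix id e.symm := rfl
    rw [IsRealization, Matrix.mul_assoc, charMat_inv_mul_eq h1, h3, Matrix.submatrix_mul_equiv,
      Matrix.submatrix_id_id, hH]
  · rw [solvesFrom_iff]
    intro τ
    have h1 := (hx τ).map (LinearMap.toContinuousLinearMap (LinearMap.funLeft ℝ ℝ e.symm))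
    rw [map_zero] at h1
    refine h1.congr (fun _ _ => rfl) fun t _ => ?_
    ext i
    simp only [Pi.add_apply, LinearMap.coe_toContinuousLinearMap', LinearMap.funLeft_apply]
    congr 1
    exact Fintype.sum_equiv e.symm _ _ fun j => by simp
  · rw [hy t ht]
    congr 1
    ext i
    exact (Fintype.sum_equiv e.symm _ _ fun j => by simp).symm

/-- Series connection. -/
theorem Response.series {p q r : ℕ} {H₁ : Transfer p q} {H₂ : Transfer q r}
    {u : ℝ → Fin r → ℝ} {w : ℝ → Fin q → ℝ} {y : ℝ → Fin p → ℝ}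
    (h₂ : Response H₂ u w) (h₁ : Response H₁ w y) : Response (H₁ * H₂) u y := by
  obtain ⟨N₂, A₂, B₂, C₂, D₂, x₂, hr₂, hx₂, hy₂⟩ := h₂
  obtain ⟨N₁, A₁, B₁, C₁, D₁, x₁, hr₁, hx₁, hy₁⟩ := h₁
  have hm : ∀ {a b c : ℕ} (M : Matrix (Fin a) (Fin b) ℝ) (M' : Matrix (Fin b) (Fin c) ℝ),
      (M * M').map RatFunc.C = gain M * gain M' := fun M M' => Matrix.map_mul
  -- The states are stacked. The first system is driven by the output of the second, so the upper
  -- block of `X` carries the factor `H₂`.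
  refine Response.of_fintype (ι := Fin N₁ ⊕ Fin N₂) (x := fun t => Sum.elim (x₁ t) (x₂ t))
    (Matrix.fromBlocks A₁ (B₁ * C₂) 0 A₂) (Matrix.fromRows (B₁ * D₂) B₂)
    (Matrix.fromCols C₁ (D₁ * C₂)) (D₁ * D₂)
    (Matrix.fromRows ((charMat A₁)⁻¹ * gain B₁ * H₂) ((charMat A₂)⁻¹ * gain B₂)) ?_ ?_ ?_ ?_
  · have h1 : lapVar • (1 : Matrix (Fin N₁ ⊕ Fin N₂) (Fin N₁ ⊕ Fin N₂) (RatFunc ℝ))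
        - (Matrix.fromBlocks A₁ (B₁ * C₂) 0 A₂).map RatFunc.C
        = Matrix.fromBlocks (charMat A₁) (-(gain B₁ * gain C₂)) 0 (charMat A₂) := by
      rw [Matrix.fromBlocks_map, hm, ← Matrix.fromBlocks_one, Matrix.fromBlocks_smul,
        sub_eq_add_neg, Matrix.fromBlocks_neg, Matrix.fromBlocks_add]
      simp [charMat, gain, sub_eq_add_neg, Matrix.map_zero]
    rw [h1, Matrix.fromBlocks_mul_fromRows]
    ext i j
    rcases i with i | i
    · simp only [Matrix.fromRows_apply_inl, Matrix.map_apply]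
      rw [← Matrix.map_apply (f := RatFunc.C), hm, ← Matrix.mul_assoc, ← Matrix.mul_assoc,
        charMat_mul_inv, Matrix.one_mul, hr₂]
      rw [Matrix.mul_add]
      simp only [Matrix.neg_mul, Matrix.mul_assoc]
      rw [add_comm, neg_add_cancel_left]
    · simp only [Matrix.fromRows_apply_inr, Matrix.map_apply]
      rw [Matrix.zero_mul, zero_add, ← Matrix.mul_assoc, charMat_mul_inv, Matrix.one_mul]
      rfl
  · rw [Matrix.fromCols_map, Matrix.fromCols_mul_fromRows, hm]
    have h2 : gain (D₁ * D₂) = gain D₁ * gain D₂ := hm _ _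
    have h3 : C₁.map RatFunc.C = gain C₁ := rfl
    rw [h2, h3, hr₁, hr₂]
    simp only [Matrix.add_mul, Matrix.mul_add, Matrix.mul_assoc]
    abel
  · intro τ
    refine ((solvesFrom_iff.mp hx₁ τ).sumElim (solvesFrom_iff.mp hx₂ τ)).congr'
      (by simp) (fun _ _ => rfl) fun t ht => ?_
    rw [hy₂ t ht.1, Matrix.fromBlocks_mulVec, Matrix.fromRows_mulVec]
    ext i
    rcases i with i | i <;>
      simp [Matrix.mulVec_add, Matrix.mulVec_mulVec, add_assoc]
  · intro t ht
    rw [hy₁ t ht, hy₂ t ht, Matrix.fromCols_mulVec]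
    simp only [Matrix.mulVec_add, Matrix.mulVec_mulVec, Sum.elim_comp_inl, Sum.elim_comp_inr,
      add_assoc]

/-- The defining bound of the `L₁` norm, for inputs bounded on `[0, τ]`. -/
theorem Response.norm_le {p q : ℕ} {H : Transfer p q} {u : ℝ → Fin q → ℝ} {y : ℝ → Fin p → ℝ}
    (h : Response H u y) {τ c : ℝ} (hum : Measurable ((Icc 0 τ).indicator u))
    (hu : ∀ s ∈ Icc 0 τ, ‖u s‖ ≤ c) {t : ℝ} (ht : t ∈ Icc 0 τ) :
    ENNReal.ofReal ‖y t‖ ≤ l1Norm H * ENNReal.ofReal c := by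
  obtain ⟨N, A, B, C, D, x, hr, hx, hy⟩ := h
  have hc : 0 ≤ c := (norm_nonneg _).trans (hu t ht)
  rw [solvesFrom_iff] at hx
  rcases hc.eq_or_lt with hc0 | hc0
  -- For `c = 0` the input cannot be rescaled, but then it vanishes on `[0, τ]` and so does the
  -- state.
  · have hu0 : ∀ s ∈ Icc 0 τ, u s = 0 := fun s hs => norm_le_zero_iff.mp (hc0 ▸ hu s hs)
    have hx0 : x t = 0 := by
      refine TrajOn.eq_zero (A := mulVecCLM A) ((hx τ).congr (fun _ _ => rfl) fun s hs => ?_) t ht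
      simp [hu0 s hs]
    simp [hy t ht.1, hx0, hu0 t ht]
  -- The truncated and rescaled input is admissible in the supremum defining `l1Norm`; by uniqueness
  -- its response on `[0, τ]` is the original one divided by `c`.
  set w : ℝ → Fin q → ℝ := fun s => c⁻¹ • (Icc 0 τ).indicator u s with hw
  have hwm : Measurable w := hum.const_smul c⁻¹
  have hw1 : ∀ s, ‖w s‖ ≤ 1 := by
    intro s
    by_cases hs : s ∈ Icc 0 τ
    · simp only [hw, indicator_of_mem hs, norm_smul, norm_inv, Real.norm_of_nonneg hc]
      rw [inv_mul_le_iff₀ hc0, mul_one]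
      exact hu s hs
    · simp [hw, indicator_of_notMem hs]
  have hwi : ∀ t, IntervalIntegrable w volume 0 t := fun t =>
    (intervalIntegrable_const (c := (1 : ℝ))).mono_fun hwm.aestronglyMeasurable
      (Eventually.of_forall fun s => by simpa using hw1 s)
  obtain ⟨z, hz⟩ := exists_linear_traj A 0 (f := fun t => B *ᵥ w t)
    (fun t _ => ⟨(mulVecCLM B).integrable_comp (hwi t).1, (mulVecCLM B).integrable_comp (hwi t).2⟩)
  have hzx : ∀ s ∈ Icc 0 τ, z s = c⁻¹ • x s := by
    refine TrajOn.linear_unique (A := mulVecCLM A) (f := fun t => B *ᵥ w t) (hz τ) ?_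
    refine ((hx τ).map (c⁻¹ • ContinuousLinearMap.id ℝ (Fin N → ℝ))).congr' (by simp)
      (fun _ _ => rfl) fun s hs => ?_
    simp [hw, indicator_of_mem hs, Matrix.mulVec_smul]
  have hl : linfNorm (fun t => C *ᵥ z t + D *ᵥ w t) ≤ l1Norm H := by
    unfold l1Norm
    refine le_iSup_of_le N <| le_iSup_of_le A <| le_iSup_of_le B <| le_iSup_of_le C <|
      le_iSup_of_le D <| le_iSup_of_le hr <| le_iSup_of_le w <| le_iSup_of_le hwm <|
      le_iSup_of_le ?_ <| le_iSup_of_le z <| le_iSup_of_le (solvesFrom_iff.mpr hz) le_rfl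
    exact iSup₂_le fun s _ => ENNReal.ofReal_le_one.mpr (hw1 s)
  have hyt : y t = c • (C *ᵥ z t + D *ᵥ w t) := by
    rw [hzx t ht, hy t ht.1]
    simp only [hw, indicator_of_mem ht, Matrix.mulVec_smul]
    rw [← smul_add, smul_smul, mul_inv_cancel₀ hc0.ne', one_smul]
  rw [hyt, norm_smul, Real.norm_of_nonneg hc, ENNReal.ofReal_mul hc, mul_comm]
  gcongr
  exact (le_iSup₂ (f := fun (t : ℝ) (_ : 0 ≤ t) => ENNReal.ofReal ‖C *ᵥ z t + D *ᵥ w t‖)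
    t ht.1).trans hl

/-! ### The transfer matrices of the adaptive system -/

theorem gain_one {n : ℕ} : gain (1 : Matrix (Fin n) (Fin n) ℝ) = 1 := by
  simp [gain, Matrix.map_one]

theorem gain_mul {a b c : ℕ} (M : Matrix (Fin a) (Fin b) ℝ) (M' : Matrix (Fin b) (Fin c) ℝ) :
    gain (M * M') = gain M * gain M' := Matrix.map_mul

theorem gain_zero {a b : ℕ} : gain (0 : Matrix (Fin a) (Fin b) ℝ) = 0 := by
  simp [gain, Matrix.map_zero]

theorem gain_add {a b : ℕ} (M M' : Matrix (Fin a) (Fin b) ℝ) :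
    gain (M + M') = gain M + gain M' := by
  ext; simp [gain]

theorem gain_neg {a b : ℕ} (M : Matrix (Fin a) (Fin b) ℝ) : gain (-M) = -gain M := by
  ext; simp [gain]

theorem gain_diagonal {m : ℕ} (k : Fin m → ℝ) :
    gain (Matrix.diagonal k) = Matrix.diagonal fun j => RatFunc.C (k j) := by
  simp [gain, Matrix.diagonal_map]

/-- A response from a state-space system on `Fin N`. -/
theorem Response.of_realization {N p q : ℕ} {H : Transfer p q} {A : Matrix (Fin N) (Fin N) ℝ}
    {B : Matrix (Fin N) (Fin q) ℝ} {C : Matrix (Fin p) (Fin N) ℝ} {D : Matrix (Fin p) (Fin q) ℝ}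
    {x : ℝ → Fin N → ℝ} {u : ℝ → Fin q → ℝ} {y : ℝ → Fin p → ℝ} (hr : IsRealization A B C D H)
    (hx : ∀ τ, TrajOn τ 0 x (fun t => A *ᵥ x t + B *ᵥ u t))
    (hy : ∀ t, 0 ≤ t → y t = C *ᵥ x t + D *ᵥ u t) : Response H u y :=
  ⟨N, A, B, C, D, x, hr, solvesFrom_iff.mpr hx, hy⟩

theorem Response.stateTransfer {n q : ℕ} {A : Matrix (Fin n) (Fin n) ℝ}
    {B : Matrix (Fin n) (Fin q) ℝ} {x : ℝ → Fin n → ℝ} {u : ℝ → Fin q → ℝ}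
    (hx : ∀ τ, TrajOn τ 0 x (fun t => A *ᵥ x t + B *ᵥ u t)) :
    Response (stateTransfer A B) u x :=
  .of_realization (C := 1) (D := 0)
    (by simp [IsRealization, L1Adaptive.stateTransfer, gain_one, gain_zero]) hx
    (fun t _ => by simp)

/-- The free motion, scaled by `S`, is a step response of `s S (s I - A)⁻¹`. -/
theorem Response.free {n : ℕ} {A S : Matrix (Fin n) (Fin n) ℝ} {x₀ : Fin n → ℝ}
    {x : ℝ → Fin n → ℝ} (hx : ∀ τ, TrajOn τ x₀ x (fun t => A *ᵥ x t)) :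
    Response (lapVar • (gain S * (charMat A)⁻¹)) (fun _ => x₀) (fun t => S *ᵥ x t) := by
  have hz : ∀ t, 0 ≤ t → x t = x₀ + A *ᵥ ∫ s in (0 : ℝ)..t, x s := by
    intro t ht
    rw [(hx t t ⟨ht, le_rfl⟩).2]
    congr 1
    exact (mulVecCLM A).intervalIntegral_comp_comm
      (((hx t).continuousOn).intervalIntegrable_of_Icc ht)
  -- Since `s (s I - A)⁻¹ = A (s I - A)⁻¹ + I`, the transfer matrix is proper with feedthrough `S`.
  -- The state is the primitive of `x`, which starts at zero as a zero-state response must.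
  refine .of_realization (A := A) (B := 1) (C := S * A) (D := S)
    (x := fun t => ∫ s in (0 : ℝ)..t, x s) ?_ (fun τ t ht => ?_) (fun t ht => ?_)
  · have h1 : lapVar • (charMat A)⁻¹ = gain A * (charMat A)⁻¹ + 1 := by
      have h2 : lapVar • (1 : Transfer n n) = gain A + charMat A := by simp [charMat]
      calc lapVar • (charMat A)⁻¹ = (lapVar • (1 : Transfer n n)) * (charMat A)⁻¹ := by simp
        _ = _ := by rw [h2, Matrix.add_mul, charMat_mul_inv]
    rw [IsRealization, gain_one, gain_mul, Matrix.mul_one, ← Matrix.mul_smul, h1, Matrix.mul_add,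
      Matrix.mul_one, Matrix.mul_assoc]
  · have hc : ∀ s ∈ Icc 0 t, A *ᵥ (∫ s in (0 : ℝ)..s, x s)
        + (1 : Matrix (Fin n) (Fin n) ℝ) *ᵥ x₀ = x s := by
      intro s hs
      rw [hz s hs.1, Matrix.one_mulVec, add_comm]
    rw [← uIcc_of_le ht.1] at hc
    refine ⟨((((hx t).continuousOn).intervalIntegrable_of_Icc ht.1)).congr
      fun s hs => (hc s (uIoc_subset_uIcc hs)).symm, ?_⟩
    rw [integral_congr hc, zero_add]
  · rw [← Matrix.mulVec_mulVec, ← Matrix.mulVec_add, hz t ht, add_comm]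

theorem lowPass_denom_ne_zero (k : ℝ) : lapVar + RatFunc.C k ≠ 0 := by
  have h : lapVar + RatFunc.C k
      = algebraMap (Polynomial ℝ) (RatFunc ℝ) (Polynomial.X + Polynomial.C k) := by simp
  rw [h, ne_eq, map_eq_zero_iff _ (RatFunc.algebraMap_injective ℝ)]
  exact (Polynomial.monic_X_add_C k).ne_zero

theorem charMat_neg_diagonal {m : ℕ} (k : Fin m → ℝ) :
    charMat (-Matrix.diagonal k) = Matrix.diagonal fun j => lapVar + RatFunc.C (k j) := by
  rw [charMat, gain_neg, gain_diagonal, sub_neg_eq_add, ← Matrix.diagonal_one,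
    ← Matrix.diagonal_smul, Matrix.diagonal_add]
  simp

theorem charMat_filter_inv_mul {m : ℕ} (k : Fin m → ℝ) :
    (charMat (-Matrix.diagonal k))⁻¹ * gain (Matrix.diagonal k) = filterTF k := by
  refine charMat_inv_mul_eq ?_
  rw [charMat_neg_diagonal, gain_diagonal, filterTF, Matrix.diagonal_mul_diagonal]
  congr 1
  ext j
  rw [lowPass, mul_div_cancel₀ _ (lowPass_denom_ne_zero (k j))]

/-- `w` is the output of the low-pass filters `C(s)` with input `u`. -/
def Filtered {m : ℕ} (k : Fin m → ℝ) (u w : ℝ → Fin m → ℝ) : Prop :=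
  ∀ τ, TrajOn τ 0 w (fun t => -Matrix.diagonal k *ᵥ w t + Matrix.diagonal k *ᵥ u t)

theorem Filtered.response {m : ℕ} {k : Fin m → ℝ} {u w : ℝ → Fin m → ℝ} (h : Filtered k u w) :
    Response (filterTF k) u w :=
  .of_realization (C := 1) (D := 0)
    (by rw [IsRealization, Matrix.mul_assoc, charMat_filter_inv_mul, gain_zero, gain_one,
      Matrix.one_mul, add_zero]) h
    (fun t _ => by simp)

theorem Filtered.response_compl {m : ℕ} {k : Fin m → ℝ} {u w : ℝ → Fin m → ℝ}
    (h : Filtered k u w) : Response (1 - filterTF k) u (fun t => u t - w t) :=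
  .of_realization (C := -1) (D := 1)
    (by rw [IsRealization, Matrix.mul_assoc, charMat_filter_inv_mul, gain_neg, gain_one]
        rw [Matrix.neg_mul, Matrix.one_mul]; abel) h
    (fun t _ => by rw [Matrix.neg_mulVec, Matrix.one_mulVec, Matrix.one_mulVec]; abel)

theorem Filtered.response_entry {m : ℕ} {k : Fin m → ℝ} {u w : ℝ → Fin m → ℝ}
    (h : Filtered k u w) (j : Fin m) :
    Response (filterEntry (k j)) (fun t _ => u t j) (fun t _ => w t j) := by
  refine Filtered.response (m := 1) (k := fun _ => k j) (fun τ => ?_) |>.congr_transfer ?_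
  · refine ((h τ).map (LinearMap.toContinuousLinearMap
      (LinearMap.funLeft ℝ ℝ (fun _ : Fin 1 => j)))).congr' (by simp) (fun _ _ => rfl)
      fun t _ => ?_
    ext i
    simp [LinearMap.funLeft_apply, Matrix.mulVec_diagonal]
  · ext a b
    simp [filterTF, filterEntry, Subsingleton.elim a b]

/-- `G(s) = (s I - A)⁻¹ B (I - C(s))`. -/
theorem Filtered.filteredTransfer {n m : ℕ} {k : Fin m → ℝ} {u w : ℝ → Fin m → ℝ}
    (h : Filtered k u w) {A : Matrix (Fin n) (Fin n) ℝ} {B : Matrix (Fin n) (Fin m) ℝ}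
    {x : ℝ → Fin n → ℝ} (hx : ∀ τ, TrajOn τ 0 x (fun t => A *ᵥ x t + B *ᵥ (u t - w t))) :
    Response (filteredTransfer A B k) u x :=
  h.response_compl.series (.stateTransfer hx)

/-- If `M ẋ = M A_e x + η`, then the filtered signal `C(s) η` is the response of
`C(s) M (s I - A_e)` to `x`. -/
theorem Filtered.response_inverse {n m : ℕ} {k : Fin m → ℝ} (hk : ∀ j, k j ≠ 0)
    {η p : ℝ → Fin m → ℝ} (h : Filtered k η p) {M : Matrix (Fin m) (Fin n) ℝ}
    {Ae : Matrix (Fin n) (Fin n) ℝ} {x : ℝ → Fin n → ℝ}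
    (hx : ∀ τ, TrajOn τ 0 (fun t => M *ᵥ x t) (fun t => M *ᵥ (Ae *ᵥ x t) + η t)) :
    Response (filterTF k * gain M * charMat Ae) x p := by
  set K := Matrix.diagonal k with hK
  set K' := Matrix.diagonal (fun j => (k j)⁻¹) with hK'
  have hKK : K' * K = 1 := by
    rw [hK, hK', Matrix.diagonal_mul_diagonal, ← Matrix.diagonal_one]
    congr 1
    ext j
    exact inv_mul_cancel₀ (hk j)
  have hKK' : K * K' = 1 := mul_eq_one_comm.mp hKK
  -- The improper factor `s I - A_e` is tamed by the first-order roll-off of the filter. With the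
  -- state `M x - K⁻¹ p` the signal `η` cancels from the derivative, leaving `x` as the only input,
  -- and the output `-K (M x - K⁻¹ p) + K M x` is `p`.
  refine .of_realization (A := -K) (B := K * M + M * Ae) (C := -K) (D := K * M)
    (x := fun t => M *ᵥ x t - K' *ᵥ p t) ?_ (fun τ => ?_) (fun t _ => ?_)
  · have h1 : (charMat (-K))⁻¹ * gain (K * M + M * Ae)
        = gain M - (charMat (-K))⁻¹ * gain M * charMat Ae := by
      refine charMat_inv_mul_eq ?_
      rw [Matrix.mul_sub, ← Matrix.mul_assoc, ← Matrix.mul_assoc, charMat_mul_inv, Matrix.one_mul,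
        gain_add, gain_mul, gain_mul, charMat, charMat, gain_neg, Matrix.sub_mul, Matrix.mul_sub]
      simp
    have h2 : filterTF k = gain K * (charMat (-K))⁻¹ := by
      have h3 := charMat_filter_inv_mul k
      rw [← hK] at h3
      have h4 : charMat (-K) * gain K = gain K * charMat (-K) := by
        rw [hK, charMat_neg_diagonal, gain_diagonal, Matrix.diagonal_mul_diagonal,
          Matrix.diagonal_mul_diagonal]
        simp [mul_comm]
      rw [← h3]
      refine charMat_inv_mul_eq ?_
      rw [← Matrix.mul_assoc, h4, Matrix.mul_assoc, charMat_mul_inv, Matrix.mul_one]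
    rw [IsRealization, Matrix.mul_assoc (gain (-K)), h1, h2, gain_neg, gain_mul]
    simp only [Matrix.neg_mul, Matrix.mul_sub, Matrix.mul_assoc]
    abel
  · refine ((hx τ).sub ((h τ).map (mulVecCLM K'))).congr' (by simp) (fun _ _ => rfl) fun t _ => ?_
    simp only [mulVecCLM_apply, Matrix.mulVec_add, Matrix.add_mulVec, Matrix.mulVec_sub,
      Matrix.neg_mulVec _ K, Matrix.mulVec_neg, Matrix.mulVec_mulVec, ← hK, hKK,
      hKK', Matrix.one_mulVec]
    abel
  · simp only [Matrix.mulVec_sub, Matrix.mulVec_mulVec, Matrix.neg_mul, hKK', Matrix.neg_mulVec,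
      Matrix.one_mulVec]
    abel

/-! ### Hurwitz matrices -/

theorem exp_mulVec_of_eigenvector {n : ℕ} {A : Matrix (Fin n) (Fin n) ℂ} {w : Fin n → ℂ} {z : ℂ}
    (h : A *ᵥ w = z • w) : NormedSpace.exp A *ᵥ w = Complex.exp z • w := by
  have hp : ∀ k : ℕ, A ^ k *ᵥ w = z ^ k • w := by
    intro k
    induction k with
    | zero => simp
    | succ k ih => rw [pow_succ, ← Matrix.mulVec_mulVec, h, Matrix.mulVec_smul, ih, smul_smul,
        pow_succ, mul_comm]
  set T : Matrix (Fin n) (Fin n) ℂ →L[ℂ] (Fin n → ℂ) :=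
    LinearMap.toContinuousLinearMap ((Matrix.mulVecBilin ℂ ℂ).flip w) with hT
  have hTa : ∀ M, T M = M *ᵥ w := fun _ => rfl
  have h1 := (NormedSpace.exp_series_hasSum_exp' (𝕂 := ℂ) A).mapL T
  have h2 := (NormedSpace.exp_series_hasSum_exp' (𝕂 := ℂ) z).smul_const w
  simp only [hTa] at h1
  rw [← Complex.exp_eq_exp_ℂ] at h2
  refine h1.unique (h2.congr_fun ?_)
  intro k
  rw [Matrix.smul_mulVec, hp, smul_assoc]

theorem map_ofReal_mulVec {n : ℕ} (M : Matrix (Fin n) (Fin n) ℝ) (v : Fin n → ℝ) :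
    M.map (algebraMap ℝ ℂ) *ᵥ (algebraMap ℝ ℂ ∘ v) = algebraMap ℝ ℂ ∘ (M *ᵥ v) :=
  funext fun i => (RingHom.map_mulVec (algebraMap ℝ ℂ) M v i).symm

theorem isUnit_of_mulVec_injective {n : ℕ} {M : Matrix (Fin n) (Fin n) ℝ}
    (h : ∀ v, M *ᵥ v = 0 → v = 0) : IsUnit M := by
  rw [← Matrix.mulVec_injective_iff_isUnit]
  intro v w hvw
  exact sub_eq_zero.mp (h _ (by rw [Matrix.mulVec_sub, sub_eq_zero]; exact hvw))

theorem L1Adaptive.IsHurwitz.eigenvalue_re_neg {n : ℕ} {A : Matrix (Fin n) (Fin n) ℝ}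
    (hA : IsHurwitz A)
    {w : Fin n → ℂ} {z : ℂ} (hw : w ≠ 0) (h : A.map (algebraMap ℝ ℂ) *ᵥ w = z • w) : z.re < 0 := by
  refine hA z ?_
  rw [← Matrix.spectrum_toLin']
  exact (Module.End.hasEigenvalue_of_hasEigenvector (Module.End.hasEigenvector_iff.mpr
    ⟨Module.End.mem_eigenspace_iff.mpr h, hw⟩)).mem_spectrum

/-- A kernel vector would be an eigenvector for the eigenvalue `0`, whose real part is not negative.
-/
theorem L1Adaptive.IsHurwitz.isUnit {n : ℕ} {A : Matrix (Fin n) (Fin n) ℝ}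
    (hA : IsHurwitz A) : IsUnit A := by
  refine isUnit_of_mulVec_injective fun v hv => ?_
  by_contra hv0
  have h1 : A.map (algebraMap ℝ ℂ) *ᵥ (algebraMap ℝ ℂ ∘ v) = (0 : ℂ) • (algebraMap ℝ ℂ ∘ v) := by
    rw [zero_smul, map_ofReal_mulVec, hv]
    ext; simp
  have h2 : (algebraMap ℝ ℂ ∘ v) ≠ 0 := by
    intro h0
    refine hv0 (funext fun i => ?_)
    simpa using congrFun h0 i
  simpa using hA.eigenvalue_re_neg h2 h1

theorem exp_map_ofReal {n : ℕ} (A : Matrix (Fin n) (Fin n) ℝ) :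
    (NormedSpace.exp A).map (algebraMap ℝ ℂ) = NormedSpace.exp (A.map (algebraMap ℝ ℂ)) := by
  refine NormedSpace.map_exp (algebraMap ℝ ℂ).mapMatrix ?_ A
  exact Continuous.matrix_map continuous_id Complex.continuous_ofReal

/-- If `exp(TA)` fixes a nonzero vector, its complex fixed space is nonzero and invariant under `A`,
so it contains an eigenvector of `A`, with eigenvalue `z` say. Then `exp(Tz) = 1` forces `Re z = 0`,
which a Hurwitz matrix excludes. -/
theorem L1Adaptive.IsHurwitz.isUnit_exp_sub_one {n : ℕ} {A : Matrix (Fin n) (Fin n) ℝ}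
    (hA : IsHurwitz A)
    {T : ℝ} (hT : 0 < T) : IsUnit (NormedSpace.exp (T • A) - 1) := by
  refine isUnit_of_mulVec_injective fun v hv => ?_
  by_contra hv0
  set Ac := A.map (algebraMap ℝ ℂ) with hAc
  have hTA : (T • A).map (algebraMap ℝ ℂ) = (T : ℂ) • Ac := by
    ext i j; simp [hAc]
  set E := (NormedSpace.exp (T • A)).map (algebraMap ℝ ℂ) with hE
  have hEexp : E = NormedSpace.exp ((T : ℂ) • Ac) := by rw [hE, exp_map_ofReal, hTA]
  have hcomm : Ac * E = E * Ac := by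
    rw [hEexp]
    exact (((Commute.refl Ac).smul_right (T : ℂ)).exp_right).eq
  set W : Submodule ℂ (Fin n → ℂ) := LinearMap.ker (Matrix.mulVecLin (E - 1)) with hW
  have hWmem : ∀ w, w ∈ W ↔ E *ᵥ w = w := by
    intro w
    rw [hW, LinearMap.mem_ker, Matrix.mulVecLin_apply, Matrix.sub_mulVec, Matrix.one_mulVec,
      sub_eq_zero]
  have hinv : ∀ w ∈ W, Matrix.mulVecLin Ac w ∈ W := by
    intro w hw
    rw [hWmem] at hw ⊢
    rw [Matrix.mulVecLin_apply, Matrix.mulVec_mulVec, ← hcomm, ← Matrix.mulVec_mulVec, hw]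
  have hvW : (algebraMap ℝ ℂ ∘ v) ∈ W := by
    rw [hWmem, hE, map_ofReal_mulVec]
    congr 1
    rw [Matrix.sub_mulVec, Matrix.one_mulVec, sub_eq_zero] at hv
    exact hv
  have : Nontrivial W := by
    refine ⟨⟨⟨_, hvW⟩, 0, fun h0 => hv0 (funext fun i => ?_)⟩⟩
    simpa using congrFun (congrArg Subtype.val h0) i
  obtain ⟨z, hz⟩ := Module.End.exists_eigenvalue ((Matrix.mulVecLin Ac).restrict hinv)
  obtain ⟨w, hw⟩ := hz.exists_hasEigenvector
  have hw1 : Ac *ᵥ (w : Fin n → ℂ) = z • (w : Fin n → ℂ) :=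
    congrArg Subtype.val hw.apply_eq_smul
  have hw0 : (w : Fin n → ℂ) ≠ 0 := fun h0 => hw.2 (Subtype.ext h0)
  have hre := hA.eigenvalue_re_neg hw0 hw1
  have hTw : ((T : ℂ) • Ac) *ᵥ (w : Fin n → ℂ) = (T * z) • (w : Fin n → ℂ) := by
    rw [Matrix.smul_mulVec, hw1, smul_smul]
  have h1 := exp_mulVec_of_eigenvector hTw
  rw [← hEexp, (hWmem _).mp w.2] at h1
  have h2 : Complex.exp (T * z) = 1 := by
    have h3 : (Complex.exp (T * z) - 1) • (w : Fin n → ℂ) = 0 := by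
      rw [sub_smul, one_smul, ← h1, sub_self]
    exact sub_eq_zero.mp ((smul_eq_zero.mp h3).resolve_right hw0)
  have h3 := congrArg norm h2
  rw [Complex.norm_exp, norm_one, Real.exp_eq_one_iff] at h3
  simp only [Complex.mul_re, Complex.ofReal_re, Complex.ofReal_im, zero_mul, sub_zero] at h3
  nlinarith

/-! ### Invertibility of `Phi` and `BB`; the pseudo-inverse of `B` -/

namespace L1Adaptive.Params

variable {n m : ℕ} {P : Params n m}

theorem isUnit_Phi (hAe : IsHurwitz P.Ae) (hT : 0 < P.T) : IsUnit P.Phi :=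
  (Matrix.isUnit_nonsing_inv_iff.mpr hAe.isUnit).mul (hAe.isUnit_exp_sub_one hT)

theorem isUnit_BB {hmn : m ≤ n} (h : (P.BB hmn).rank = n) : IsUnit (P.BB hmn) := by
  rw [← Matrix.mulVec_injective_iff_isUnit]
  have h1 : LinearMap.range (P.BB hmn).mulVecLin = ⊤ :=
    Submodule.eq_top_of_finrank_eq (by rw [← Matrix.rank, h]; simp)
  exact (LinearMap.injective_iff_surjective (f := (P.BB hmn).mulVecLin)).mpr
    (LinearMap.range_eq_top.mp h1)

/-- `[B  B^⊥] (a, c) = B a + B^⊥ c`. -/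
theorem BB_mulVec (hmn : m ≤ n) (σ : Fin n → ℝ) : P.BB hmn *ᵥ σ
    = P.B *ᵥ (fun j => σ (Fin.cast (Nat.add_sub_of_le hmn) (Fin.castAdd (n - m) j)))
      + P.Bperp *ᵥ (fun j => σ (Fin.cast (Nat.add_sub_of_le hmn) (Fin.natAdd m j))) := by
  ext r
  simp only [Matrix.mulVec, dotProduct, Pi.add_apply, BB, Matrix.of_apply]
  rw [← Equiv.sum_comp (finCongr (Nat.add_sub_of_le hmn)), Fin.sum_univ_add]
  simp

theorem mulVec_B_injective {hmn : m ≤ n} (h : (P.BB hmn).rank = n) :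
    Function.Injective P.B.mulVec := by
  have hinj := Matrix.mulVec_injective_iff_isUnit.mpr (isUnit_BB h)
  intro a c hac
  -- Padding with zeros turns `B a` into a value of the invertible matrix `[B B^⊥]`.
  set ext : (Fin m → ℝ) → Fin n → ℝ := fun a =>
    Fin.append a 0 ∘ Fin.cast (Nat.add_sub_of_le hmn).symm with hext
  have h1 : ∀ a, P.BB hmn *ᵥ ext a = P.B *ᵥ a := by
    intro a
    rw [BB_mulVec]
    have h2 : (fun j => ext a (Fin.cast (Nat.add_sub_of_le hmn) (Fin.castAdd (n - m) j))) = a := by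
      ext j; simp [hext]
    have h3 : (fun j => ext a (Fin.cast (Nat.add_sub_of_le hmn) (Fin.natAdd m j))) = 0 := by
      ext j; simp [hext]
    rw [h2, h3, Matrix.mulVec_zero, add_zero]
  have h2 := hinj (((h1 a).trans hac).trans (h1 c).symm)
  ext j
  have := congrFun h2 (Fin.cast (Nat.add_sub_of_le hmn) (Fin.castAdd (n - m) j))
  simpa [hext] using this

/-- Over the reals `BᵀB` has the same kernel as `B`, and `B` is injective, so the inverse in `pinv`
is a true inverse. -/
theorem pinv_mul_self {hmn : m ≤ n} (h : (P.BB hmn).rank = n) : pinv P.B * P.B = 1 := by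
  rw [pinv, Matrix.mul_assoc]
  refine Matrix.nonsing_inv_mul _ ((Matrix.isUnit_iff_isUnit_det _).mp ?_)
  refine isUnit_of_mulVec_injective fun v hv => ?_
  have h1 : v ∈ LinearMap.ker (P.Bᵀ * P.B).mulVecLin := hv
  rw [Matrix.ker_mulVecLin_transpose_mul_self] at h1
  exact mulVec_B_injective h ((show P.B *ᵥ v = 0 from h1).trans (Matrix.mulVec_zero _).symm)

/-- Together with `pinv_mul_self`, this lets `B†` extract the matched estimate `σ̂₁` from the
prediction-error equation. -/
theorem pinv_mul_perp (h : P.Bperpᵀ * P.B = 0) : pinv P.B * P.Bperp = 0 := by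
  have h1 : P.Bᵀ * P.Bperp = 0 := by
    rw [← Matrix.transpose_transpose (P.Bᵀ * P.Bperp), Matrix.transpose_mul,
      Matrix.transpose_transpose, h, Matrix.transpose_zero]
  rw [pinv, Matrix.mul_assoc, h1, Matrix.mul_zero]

end L1Adaptive.Params

/-! ### The prediction error under the sampled adaptive law -/

/-- The estimate is updated at the end of a sampling period, so there the right-hand sides agree on
the half-open interval only; the endpoint is a null set. -/
theorem TrajOn.congr_Ico {E : Type*} [NormedAddCommGroup E] [NormedSpace ℝ E] {τ : ℝ} {x₀ : E}
    {x g h : ℝ → E} (H : TrajOn τ x₀ x g) (hg : ∀ t ∈ Ico 0 τ, h t = g t) : TrajOn τ x₀ x h := by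
  intro t ht
  have h1 : ∀ᵐ s ∂(volume : Measure ℝ), s ∈ uIoc 0 t → g s = h s := by
    have h2 : ∀ᵐ s ∂(volume : Measure ℝ), s ≠ τ := by simp [ae_iff]
    filter_upwards [h2] with s hs hst
    rw [uIoc_of_le ht.1] at hst
    exact (hg s ⟨hst.1.le, lt_of_le_of_ne (hst.2.trans ht.2) hs⟩).symm
  refine ⟨(H t ht).1.congr_ae ((ae_restrict_iff' measurableSet_uIoc).mpr h1), ?_⟩
  rw [(H t ht).2, integral_congr_ae h1]

theorem TrajOn.shift {E : Type*} [NormedAddCommGroup E] [NormedSpace ℝ E] {τ a : ℝ} {x₀ : E}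
    {x g : ℝ → E} (H : TrajOn τ x₀ x g) (ha : 0 ≤ a) :
    TrajOn (τ - a) (x a) (fun t => x (a + t)) (fun t => g (a + t)) := by
  intro t ht
  have h1 := H a ⟨ha, by linarith [ht.1, ht.2]⟩
  have h2 := H (a + t) ⟨by linarith [ht.1], by linarith [ht.2]⟩
  have h3 : IntervalIntegrable g volume a (a + t) := h1.1.symm.trans h2.1
  refine ⟨by simpa using h3.comp_add_left a, ?_⟩
  simp only
  rw [integral_comp_add_left (fun s => g s), add_zero, h2.2, h1.2, add_assoc,
    integral_add_adjacent_intervals h1.1 h3]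

/-- Both sides solve `ẏ = A y + v` with `y(0) = 0`. For `A = A_e` this identifies `Φ(T)` as the
effect at time `T` of an input held constant over a period. -/
theorem integral_exp_smul_mulVec {ι : Type*} [Fintype ι] [DecidableEq ι] {A : Matrix ι ι ℝ}
    (hA : IsUnit A) {T : ℝ} (hT : 0 ≤ T) (v : ι → ℝ) :
    ∫ s in (0 : ℝ)..T, NormedSpace.exp ((T - s) • A) *ᵥ v
      = (A⁻¹ * (NormedSpace.exp (T • A) - 1)) *ᵥ v := by
  have hdet := (Matrix.isUnit_iff_isUnit_det A).mp hA
  have hEc := continuous_exp_smul A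
  have h1 : ∀ t : ℝ, A *ᵥ ((A⁻¹ * (NormedSpace.exp (t • A) - 1)) *ᵥ v) + v
      = NormedSpace.exp (t • A) *ᵥ v := by
    intro t
    rw [Matrix.mulVec_mulVec, ← Matrix.mul_assoc, Matrix.mul_nonsing_inv _ hdet, Matrix.one_mul,
      Matrix.sub_mulVec, Matrix.one_mulVec, sub_add_cancel]
  have h2 : TrajOn T 0 (fun t => (A⁻¹ * (NormedSpace.exp (t • A) - 1)) *ᵥ v)
      (fun t => A *ᵥ ((A⁻¹ * (NormedSpace.exp (t • A) - 1)) *ᵥ v) + v) := by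
    simp only [h1]
    refine TrajOn.of_hasDerivWithinAt
      (hEc.continuousOn.matrix_mulVec continuousOn_const) (fun t _ => ?_) (by simp)
    have h3 := ((hasDerivAt_exp_smul A t).hasDerivWithinAt (s := Icc 0 T)).mulVec
      (hasDerivWithinAt_const t (Icc 0 T) v)
    have h4 := (mulVecCLM A⁻¹).hasFDerivAt.comp_hasDerivWithinAt t (h3.sub_const v)
    refine (h4.congr_deriv ?_).congr (fun s _ => ?_) ?_
    · simp only [Matrix.mulVec_zero, add_zero, mulVecCLM_apply, Matrix.mulVec_mulVec]
      rw [← Matrix.mul_assoc, Matrix.nonsing_inv_mul _ hdet, Matrix.one_mul]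
    · simp [Matrix.sub_mulVec, ← Matrix.mulVec_mulVec]
    · simp [Matrix.sub_mulVec, ← Matrix.mulVec_mulVec]
  have h3 := h2.variation_of_constants (f := fun _ => v) continuousOn_const ⟨hT, le_rfl⟩
  rw [Matrix.mulVec_zero, zero_add] at h3
  exact h3.symm

/-- After reflection the integrals are those of `N` over `[0, t]` and `[0, T]`, so the value at `T`
dominates. -/
theorem integral_reverse_le {N : ℝ → ℝ} (hN : Continuous N) (h0 : ∀ s, 0 ≤ N s) {t T : ℝ}
    (ht : 0 ≤ t) (htT : t ≤ T) :
    ∫ s in (0 : ℝ)..t, N (t - s) ≤ ∫ s in (0 : ℝ)..T, N (T - s) := by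
  rw [integral_comp_sub_left, integral_comp_sub_left, sub_self, sub_self, sub_zero, sub_zero]
  exact integral_mono_interval le_rfl ht htT (Eventually.of_forall h0) (hN.intervalIntegrable _ _)

theorem norm_integral_exp_mulVec_le {ι κ : Type*} [Fintype ι] [DecidableEq ι] [Fintype κ]
    (A : Matrix ι ι ℝ) (B : Matrix ι κ ℝ) {f : ℝ → κ → ℝ} {t c : ℝ} (ht : 0 ≤ t)
    (hf : ∀ s ∈ Icc 0 t, ‖f s‖ ≤ c) :
    ‖∫ s in (0 : ℝ)..t, NormedSpace.exp ((t - s) • A) *ᵥ (B *ᵥ f s)‖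
      ≤ (∫ s in (0 : ℝ)..t, ‖NormedSpace.exp ((t - s) • A) * B‖) * c := by
  rw [← intervalIntegral.integral_mul_const]
  refine norm_integral_le_of_norm_le ht (Eventually.of_forall fun s hs => ?_) ?_
  · rw [Matrix.mulVec_mulVec]
    exact (linfty_opNorm_mulVec _ _).trans
      (mul_le_mul_of_nonneg_left (hf s ⟨hs.1.le, hs.2⟩) (norm_nonneg _))
  · refine Continuous.intervalIntegrable ?_ _ _
    have : Continuous fun s : ℝ => NormedSpace.exp ((t - s) • A) :=
      (continuous_exp_smul A).comp (continuous_const.sub continuous_id)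
    exact ((this.matrix_mul continuous_const).norm).mul continuous_const

namespace L1Adaptive.Params

variable {n m : ℕ} {P : Params n m}

theorem continuous_norm_exp_mul (A : Matrix (Fin n) (Fin n) ℝ) {q : ℕ}
    (M : Matrix (Fin n) (Fin q) ℝ) :
    Continuous fun s : ℝ => ‖NormedSpace.exp (s • A) * M‖ :=
  ((continuous_exp_smul A).matrix_mul continuous_const).norm

theorem integral_norm_exp_mul_B_le {t : ℝ} (ht : t ∈ Icc 0 P.T) :
    ∫ s in (0 : ℝ)..t, ‖NormedSpace.exp ((t - s) • P.Ae) * P.B‖ ≤ P.alpha0 :=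
  integral_reverse_le (continuous_norm_exp_mul P.Ae P.B) (fun _ => norm_nonneg _) ht.1 ht.2

theorem alpha0_nonneg (hT : 0 < P.T) : 0 ≤ P.alpha0 :=
  integral_nonneg hT.le fun _ _ => norm_nonneg _

/-- A real `sSup` bounds the members of its set only if the set is bounded above; here this follows
from compactness. -/
theorem norm_exp_le_alpha1 {t : ℝ} (ht : t ∈ Icc 0 P.T) :
    ‖NormedSpace.exp (t • P.Ae)‖ ≤ P.alpha1 := by
  refine le_csSup ?_ (mem_image_of_mem _ ht)
  exact (isCompact_Icc.image (continuous_exp_smul P.Ae).norm).bddAbove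

theorem integral_norm_le_alpha2 {t : ℝ} (ht : t ∈ Icc 0 P.T) :
    ∫ s in (0 : ℝ)..t, ‖NormedSpace.exp ((t - s) • P.Ae)
      * (P.Phi⁻¹ * NormedSpace.exp (P.T • P.Ae))‖ ≤ P.alpha2 := by
  simp only [← Matrix.mul_assoc]
  refine le_csSup ?_ (mem_image_of_mem _ ht)
  refine ⟨∫ s in (0 : ℝ)..P.T, ‖NormedSpace.exp ((P.T - s) • P.Ae)
      * (P.Phi⁻¹ * NormedSpace.exp (P.T • P.Ae))‖, ?_⟩
  rintro _ ⟨t, ht, rfl⟩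
  have := integral_reverse_le (continuous_norm_exp_mul P.Ae
    (P.Phi⁻¹ * NormedSpace.exp (P.T • P.Ae))) (fun _ => norm_nonneg _) ht.1 ht.2
  simp only [← Matrix.mul_assoc] at this ⊢
  exact this

/-- The prediction error within a sampling period, with value `y₀` at its start. -/
theorem sample_period {y₀ : Fin n → ℝ} {y : ℝ → Fin n → ℝ} {G : ℝ → Fin m → ℝ} {h b : ℝ}
    (hh : h ≤ P.T)
    (hy : TrajOn h y₀ y (fun t => P.Ae *ᵥ y t
      + (-((P.Phi⁻¹ * NormedSpace.exp (P.T • P.Ae)) *ᵥ y₀) - P.B *ᵥ G t)))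
    (hG : ContinuousOn G (Icc 0 h)) (hGb : ∀ s ∈ Icc 0 h, ‖G s‖ ≤ b) {t : ℝ} (ht : t ∈ Icc 0 h) :
    ‖y t‖ ≤ (P.alpha1 + P.alpha2) * ‖y₀‖ + b * P.alpha0 ∧
      (IsHurwitz P.Ae → 0 < P.T → t = P.T → ‖y t‖ ≤ b * P.alpha0) := by
  have htT : t ∈ Icc 0 P.T := ⟨ht.1, ht.2.trans hh⟩
  have hsub : Icc 0 t ⊆ Icc 0 h := Icc_subset_Icc_right ht.2
  have hb : 0 ≤ b := (norm_nonneg _).trans (hGb t ht)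
  set D := P.Phi⁻¹ * NormedSpace.exp (P.T • P.Ae) with hD
  have hEc : Continuous fun s : ℝ => NormedSpace.exp ((t - s) • P.Ae) :=
    (continuous_exp_smul P.Ae).comp (continuous_const.sub continuous_id)
  have hv := hy.variation_of_constants (continuousOn_const.sub hG.mulVec_const) ht
  have h1 : IntervalIntegrable (fun s => NormedSpace.exp ((t - s) • P.Ae) *ᵥ (D *ᵥ y₀))
      volume 0 t :=
    (hEc.continuousOn.matrix_mulVec continuousOn_const).intervalIntegrable
  have h2 : IntervalIntegrable (fun s => NormedSpace.exp ((t - s) • P.Ae) *ᵥ (P.B *ᵥ G s))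
      volume 0 t :=
    (hEc.continuousOn.matrix_mulVec (hG.mono hsub).mulVec_const).intervalIntegrable_of_Icc ht.1
  have h3 : y t = NormedSpace.exp (t • P.Ae) *ᵥ y₀
      - (∫ s in (0 : ℝ)..t, NormedSpace.exp ((t - s) • P.Ae) *ᵥ (D *ᵥ y₀))
      - ∫ s in (0 : ℝ)..t, NormedSpace.exp ((t - s) • P.Ae) *ᵥ (P.B *ᵥ G s) := by
    rw [hv, sub_sub, ← integral_add h1 h2, sub_eq_add_neg, ← intervalIntegral.integral_neg]
    congr 1
    refine integral_congr fun s _ => ?_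
    simp only [Matrix.mulVec_sub, Matrix.mulVec_neg]
    abel
  have h4 : ‖∫ s in (0 : ℝ)..t, NormedSpace.exp ((t - s) • P.Ae) *ᵥ (P.B *ᵥ G s)‖
      ≤ b * P.alpha0 := by
    rw [mul_comm]
    exact (norm_integral_exp_mulVec_le _ _ ht.1 fun s hs => hGb s (hsub hs)).trans
      (mul_le_mul_of_nonneg_right (integral_norm_exp_mul_B_le htT) hb)
  refine ⟨?_, fun hAe hT htT' => ?_⟩
  · have h5 : ‖NormedSpace.exp (t • P.Ae) *ᵥ y₀‖ ≤ P.alpha1 * ‖y₀‖ :=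
      (linfty_opNorm_mulVec _ _).trans
        (mul_le_mul_of_nonneg_right (norm_exp_le_alpha1 htT) (norm_nonneg _))
    have h6 : ‖∫ s in (0 : ℝ)..t, NormedSpace.exp ((t - s) • P.Ae) *ᵥ (D *ᵥ y₀)‖
        ≤ P.alpha2 * ‖y₀‖ :=
      (norm_integral_exp_mulVec_le _ _ ht.1 fun s hs => le_rfl).trans
        (mul_le_mul_of_nonneg_right (integral_norm_le_alpha2 htT) (norm_nonneg _))
    rw [h3]
    refine (norm_sub_le _ _).trans (add_le_add ((norm_sub_le _ _).trans ?_) h4)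
    rw [add_mul]
    exact add_le_add h5 h6
  · have hΦ := (Matrix.isUnit_iff_isUnit_det _).mp (isUnit_Phi hAe hT)
    rw [htT', integral_exp_smul_mulVec hAe.isUnit hT.le] at h3
    -- This is the purpose of the adaptive law: over a full period, the constant input derived from
    -- `y₀` exactly cancels the free motion from `y₀`.
    have h5 : (P.Ae⁻¹ * (NormedSpace.exp (P.T • P.Ae) - 1)) *ᵥ (D *ᵥ y₀)
        = NormedSpace.exp (P.T • P.Ae) *ᵥ y₀ := by
      change P.Phi *ᵥ (D *ᵥ y₀) = _
      rw [Matrix.mulVec_mulVec, hD, ← Matrix.mul_assoc, Matrix.mul_nonsing_inv _ hΦ, Matrix.one_mul]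
    rw [h5, sub_self, zero_sub] at h3
    rw [htT', h3, norm_neg, ← htT']
    exact h4

/-- The prediction error is at most `γ₀(T)` as long as the uncertainty is at most `b`. -/
theorem norm_predictionError_le (hmn : m ≤ n) (hAe : IsHurwitz P.Ae) (hrank : (P.BB hmn).rank = n)
    (hT : 0 < P.T) {F : ℝ → Fin m → ℝ} {xt : ℝ → Fin n → ℝ} {t₁ b : ℝ}
    (hxt : TrajOn t₁ 0 xt (fun t => P.Ae *ᵥ xt t
      + (P.BB hmn *ᵥ P.sigmaHat hmn xt t - P.B *ᵥ F t)))
    (hF : ContinuousOn F (Icc 0 t₁)) (hFb : ∀ s ∈ Icc 0 t₁, ‖F s‖ ≤ b) {t : ℝ}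
    (ht : t ∈ Icc 0 t₁) : ‖xt t‖ ≤ P.gamma0 b := by
  have hBB := (Matrix.isUnit_iff_isUnit_det _).mp (isUnit_BB hrank)
  set D := P.Phi⁻¹ * NormedSpace.exp (P.T • P.Ae) with hD
  have hσ : ∀ t, P.BB hmn *ᵥ P.sigmaHat hmn xt t = -(D *ᵥ xt ((⌊t / P.T⌋₊ : ℝ) * P.T)) := by
    intro t
    rw [sigmaHat, Matrix.mulVec_neg, Matrix.mulVec_mulVec, Matrix.mul_assoc, ← Matrix.mul_assoc,
      Matrix.mul_nonsing_inv _ hBB, Matrix.one_mul]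
  have hper : ∀ (i : ℕ) (h : ℝ), h ≤ P.T → i * P.T + h ≤ t₁ →
      TrajOn h (xt (i * P.T)) (fun s => xt (i * P.T + s)) (fun s => P.Ae *ᵥ xt (i * P.T + s)
        + (-(D *ᵥ xt (i * P.T)) - P.B *ᵥ F (i * P.T + s))) := by
    intro i h hh hi
    refine ((hxt.shift (a := i * P.T) (by positivity)).mono (by linarith)).congr_Ico
      fun s hs => ?_
    have hfl : ⌊(i * P.T + s) / P.T⌋₊ = i := by
      rw [Nat.floor_eq_iff (by have := hs.1; positivity), le_div_iff₀ hT, div_lt_iff₀ hT]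
      exact ⟨by linarith [hs.1], by linarith [hs.2]⟩
    rw [hσ, hfl]
  have hmem : ∀ (i : ℕ) (h : ℝ), i * P.T + h ≤ t₁ → ∀ s ∈ Icc 0 h, i * P.T + s ∈ Icc 0 t₁ :=
    fun i h hi s hs => ⟨by have := hs.1; positivity, by linarith [hs.2]⟩
  have hcont : ∀ (i : ℕ) (h : ℝ), i * P.T + h ≤ t₁ →
      ContinuousOn (fun s => F (i * P.T + s)) (Icc 0 h) := fun i h hi =>
    hF.comp (continuous_const.add continuous_id).continuousOn (hmem i h hi)
  have hb : 0 ≤ b := (norm_nonneg _).trans (hFb t ht)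
  have hα0 := alpha0_nonneg hT
  -- A case distinction replaces induction, because the error at the end of a period does not depend
  -- on its value at the start.
  have hsamp : ∀ i : ℕ, i * P.T ≤ t₁ → ‖xt (i * P.T)‖ ≤ b * P.alpha0 := by
    intro i hi
    cases i with
    | zero =>
      have := hxt.init (ht.1.trans ht.2)
      simp only [Nat.cast_zero, zero_mul, this, norm_zero]
      positivity
    | succ i =>
      push_cast at hi ⊢
      have hi' : i * P.T + P.T ≤ t₁ := by linarith
      have := (sample_period le_rfl (hper i P.T le_rfl hi') (hcont i P.T hi')
        (fun s hs => hFb _ (hmem i P.T hi' s hs)) ⟨hT.le, le_rfl⟩).2 hAe hT rfl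
      rwa [add_mul, one_mul]
  set i := ⌊t / P.T⌋₊ with hi
  have h1 : i * P.T ≤ t := by
    rw [← le_div_iff₀ hT]; exact Nat.floor_le (div_nonneg ht.1 hT.le)
  have h2 : t < (i + 1) * P.T := by
    rw [← div_lt_iff₀ hT]; exact Nat.lt_floor_add_one _
  have h3 : i * P.T + (t - i * P.T) ≤ t₁ := by linarith [ht.2]
  have h4 := (sample_period (by linarith) (hper i _ (by linarith) h3) (hcont i _ h3)
        (fun s hs => hFb _ (hmem i _ h3 s hs)) (t := t - i * P.T) ⟨by linarith, le_rfl⟩).1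
  rw [add_sub_cancel] at h4
  have hα1 : 0 ≤ P.alpha1 := (norm_nonneg _).trans (norm_exp_le_alpha1 ⟨le_rfl, hT.le⟩)
  have hα2 : 0 ≤ P.alpha2 := le_trans (by simp) (integral_norm_le_alpha2 ⟨le_rfl, hT.le⟩)
  calc ‖xt t‖ ≤ (P.alpha1 + P.alpha2) * ‖xt (i * P.T)‖ + b * P.alpha0 := h4
    _ ≤ (P.alpha1 + P.alpha2) * (b * P.alpha0) + b * P.alpha0 := by
        gcongr
        exact hsamp i (h1.trans ht.2)
    _ = P.gamma0 b := by rw [gamma0]; ring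

end L1Adaptive.Params

/-! ### The uncertainty -/

theorem isCompact_Omega {n : ℕ} (ρ : ℝ) : IsCompact (Omega ρ : Set (Fin n → ℝ)) := by
  have h : (Omega ρ : Set (Fin n → ℝ)) = Metric.closedBall 0 ρ := by
    ext z; simp [Omega]
  rw [h]
  exact isCompact_closedBall 0 ρ

theorem isCompact_box {n : ℕ} (ρ : Fin n → ℝ) : IsCompact (box ρ) := by
  have h : box ρ = Set.pi univ fun i => Icc (-ρ i) (ρ i) := by
    ext z; simp [box, abs_le, Pi.le_def, forall_and]
  rw [h]
  exact isCompact_univ_pi fun _ => isCompact_Icc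

theorem le_ciSup_fin {m : ℕ} (c : Fin m → ℝ) (j : Fin m) : c j ≤ ⨆ j, c j :=
  le_ciSup (finite_range c).bddAbove j

namespace L1Adaptive.UncertaintyBounds

variable {n m : ℕ} {f : ℝ → (Fin n → ℝ) → Fin m → ℝ} {Z : Set (Fin n → ℝ)} {L l b : Fin m → ℝ}

theorem norm_le (h : UncertaintyBounds f Z L l b) {t : ℝ} (ht : 0 ≤ t) {x : Fin n → ℝ}
    (hx : x ∈ Z) : ‖f t x‖ ≤ ⨆ j, b j := by
  refine (pi_norm_le_iff_of_nonneg (Real.iSup_nonneg fun j => (h j).2.2.1.le)).mpr fun j => ?_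
  exact ((h j).2.2.2 x hx x hx t t ht ht).2.trans (le_ciSup_fin b j)

theorem iSup_L_nonneg (h : UncertaintyBounds f Z L l b) : 0 ≤ ⨆ j, L j :=
  Real.iSup_nonneg fun j => (h j).1.le

theorem norm_sub_le (h : UncertaintyBounds f Z L l b) {t : ℝ} (ht : 0 ≤ t) {x z : Fin n → ℝ}
    (hx : x ∈ Z) (hz : z ∈ Z) : ‖f t x - f t z‖ ≤ (⨆ j, L j) * ‖x - z‖ := by
  refine (pi_norm_le_iff_of_nonneg (mul_nonneg h.iSup_L_nonneg (norm_nonneg _))).mpr fun j => ?_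
  have h1 := ((h j).2.2.2 x hx z hz t t ht ht).1
  rw [sub_self, abs_zero, mul_zero, add_zero] at h1
  exact h1.trans (mul_le_mul_of_nonneg_right (le_ciSup_fin L j) (norm_nonneg _))

theorem continuousOn_comp (h : UncertaintyBounds f Z L l b) {w : ℝ → Fin n → ℝ} {s : Set ℝ}
    (hs : ∀ t ∈ s, 0 ≤ t) (hw : ContinuousOn w s) (hwZ : ∀ t ∈ s, w t ∈ Z) :
    ContinuousOn (fun t => f t (w t)) s := by
  refine continuousOn_pi.mpr fun j t₀ ht₀ => ?_
  rw [ContinuousWithinAt, tendsto_iff_norm_sub_tendsto_zero]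
  have h1 : Tendsto (fun t => L j * ‖w t - w t₀‖ + l j * |t - t₀|) (𝓝[s] t₀) (𝓝 0) := by
    have h2 := tendsto_iff_norm_sub_tendsto_zero.mp (hw t₀ ht₀)
    have h3 := tendsto_iff_norm_sub_tendsto_zero.mp
      (continuousWithinAt_id (s := s) (x := t₀) : Tendsto id _ _)
    simpa using (h2.const_mul (L j)).add (h3.const_mul (l j))
  refine squeeze_zero' (Eventually.of_forall fun _ => norm_nonneg _) ?_ h1
  filter_upwards [self_mem_nhdsWithin] with t ht
  exact ((h j).2.2.2 _ (hwZ t ht) _ (hwZ t₀ ht₀) t t₀ (hs t ht) (hs t₀ ht₀)).1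

end L1Adaptive.UncertaintyBounds

/-- The image of `[0, τ]` under the trajectory is itself a compact set to which the assumption on
`f` applies, so no bound on the trajectory is needed beforehand. -/
theorem continuousOn_uncertainty {n m : ℕ} {f : ℝ → (Fin n → ℝ) → Fin m → ℝ}
    {L l b : Set (Fin n → ℝ) → Fin m → ℝ}
    (hf : ∀ Z, IsCompact Z → UncertaintyBounds f Z (L Z) (l Z) (b Z)) {w : ℝ → Fin n → ℝ} {τ : ℝ}
    (hw : ContinuousOn w (Icc 0 τ)) : ContinuousOn (fun t => f t (w t)) (Icc 0 τ) :=
  (hf _ (isCompact_Icc.image_of_continuousOn hw)).continuousOn_comp (fun _ ht => ht.1) hw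
    fun _ ht => mem_image_of_mem w ht

/-- The coordinatewise retraction onto the ball `Ω(R)`. -/
def clampBall {n : ℕ} (R : ℝ) (z : Fin n → ℝ) : Fin n → ℝ := fun i => max (-R) (min R (z i))

theorem clampBall_mem {n : ℕ} {R : ℝ} (hR : 0 ≤ R) (z : Fin n → ℝ) : clampBall R z ∈ Omega R := by
  refine (pi_norm_le_iff_of_nonneg hR).mpr fun i => ?_
  rw [Real.norm_eq_abs, abs_le]
  exact ⟨le_max_left _ _, max_le (by linarith) (min_le_left _ _)⟩

theorem clampBall_eq {n : ℕ} {R : ℝ} {z : Fin n → ℝ} (hz : ‖z‖ ≤ R) : clampBall R z = z := by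
  ext i
  have h := abs_le.mp ((norm_le_pi_norm z i).trans hz)
  rw [clampBall, min_eq_right h.2, max_eq_right h.1]

/-- Each coordinate is clamped by a 1-Lipschitz map, so cutting `f` off preserves its Lipschitz
constant on `Ω(R)`. -/
theorem norm_clampBall_sub_le {n : ℕ} (R : ℝ) (z y : Fin n → ℝ) :
    ‖clampBall R z - clampBall R y‖ ≤ ‖z - y‖ := by
  refine (pi_norm_le_iff_of_nonneg (norm_nonneg _)).mpr fun i => ?_
  refine le_trans ?_ (norm_le_pi_norm (z - y) i)
  simp only [clampBall, Pi.sub_apply, Real.norm_eq_abs]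
  calc _ ≤ |min R (z i) - min R (y i)| := by
        simpa [max_comm (-R)] using abs_max_sub_max_le_abs (min R (z i)) (min R (y i)) (-R)
    _ ≤ |z i - y i| := by
        have := abs_min_sub_min_le_max R (z i) R (y i)
        simpa using this

/-! ### The reference system -/

section

variable {n m : ℕ} {P : Params n m} {f : ℝ → (Fin n → ℝ) → Fin m → ℝ}
  {L l b : Set (Fin n → ℝ) → Fin m → ℝ}

/-- The reference system `ẋ_r = A_m x_r + B_v v + B (f - C(s) f)`, with `f` cut off outside
`Ω(R)`, relative to the nominal trajectory: `x_r = x_n + z`. -/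
theorem exists_reference
    (hf : ∀ Z, IsCompact Z → UncertaintyBounds f Z (L Z) (l Z) (b Z)) {R τ : ℝ} (hR : 0 ≤ R)
    (hτ : 0 ≤ τ) {xn : ℝ → Fin n → ℝ} (hxn : ContinuousOn xn (Icc 0 τ)) :
    ∃ (z : ℝ → Fin n → ℝ) (φ w : ℝ → Fin m → ℝ),
      (∀ σ, TrajOn σ 0 z (fun t => P.Am *ᵥ z t + P.B *ᵥ (φ t - w t))) ∧ Filtered P.k φ w ∧
      (∀ t, IntervalIntegrable φ volume 0 t) ∧ ContinuousOn φ (Icc 0 τ) ∧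
      ∀ s ∈ Icc 0 τ, φ s = f s (clampBall R (xn s + z s)) := by
  have hfR := hf _ (isCompact_Omega (n := n) R)
  -- The state is the pair of `z` and the filter output `w`; only `z` is fed back, through the
  -- cut-off uncertainty.
  obtain ⟨Z, φ, hZ, hφi, hφc, hφ⟩ := exists_semilinear_response
    (Matrix.fromBlocks P.Am (-P.B) 0 (-Matrix.diagonal P.k))
    (Matrix.fromRows P.B (Matrix.diagonal P.k))
    (Matrix.fromCols (1 : Matrix (Fin n) (Fin n) ℝ) (0 : Matrix (Fin n) (Fin m) ℝ))
    (g := fun s z => f s (clampBall R (xn s + z))) hτ (⨆ j, b (Omega R) j).toNNReal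
    (⨆ j, L (Omega R) j).toNNReal
    (fun s hs z => (hfR.norm_le hs.1 (clampBall_mem hR _)).trans (Real.le_coe_toNNReal _))
    (fun s hs => LipschitzWith.of_dist_le_mul fun z y => by
      rw [dist_eq_norm, dist_eq_norm, Real.coe_toNNReal _ hfR.iSup_L_nonneg]
      refine (hfR.norm_sub_le hs.1 (clampBall_mem hR _) (clampBall_mem hR _)).trans
        (mul_le_mul_of_nonneg_left ((norm_clampBall_sub_le _ _ _).trans ?_) hfR.iSup_L_nonneg)
      rw [add_sub_add_left_eq_sub])
    (fun z => hfR.continuousOn_comp (fun _ hs => hs.1) (continuousOn_pi.mpr fun i =>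
      (continuous_const.max (continuous_const.min continuous_id)).comp_continuousOn
        ((continuousOn_pi.mp hxn i).add continuousOn_const)) fun _ _ => clampBall_mem hR _)
  refine ⟨fun t => Z t ∘ Sum.inl, φ, fun t => Z t ∘ Sum.inr, fun σ => ?_, fun σ => ?_, hφi, hφc,
    fun s hs => ?_⟩
  · refine ((hZ σ).map (mulVecCLM (Matrix.fromCols (1 : Matrix (Fin n) (Fin n) ℝ)
      (0 : Matrix (Fin n) (Fin m) ℝ)))).congr' (by simp) (fun t _ => ?_) (fun t _ => ?_)
    · simp [Matrix.fromCols_mulVec]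
    · simp only [mulVecCLM_apply, Matrix.fromCols_mulVec, Matrix.fromBlocks_mulVec,
        Matrix.fromRows_mulVec, Matrix.mulVec_sub]
      ext i
      simp [Function.comp_def, Matrix.neg_mulVec]
      ring
  · refine ((hZ σ).map (mulVecCLM (Matrix.fromCols (0 : Matrix (Fin m) (Fin n) ℝ)
      (1 : Matrix (Fin m) (Fin m) ℝ)))).congr' (by simp) (fun t _ => ?_) (fun t _ => ?_)
    · simp [Matrix.fromCols_mulVec]
    · ext i
      simp [Matrix.fromCols_mulVec, Matrix.fromBlocks_mulVec, Matrix.fromRows_mulVec,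
        Function.comp_def]
  · rw [hφ s hs]
    simp [Matrix.fromCols_mulVec]

theorem Response.norm_le_linfNorm {p q : ℕ} {H : Transfer p q} {u : ℝ → Fin q → ℝ}
    {y : ℝ → Fin p → ℝ} (h : Response H u y) (hum : Measurable u) (hu : linfNorm u < ⊤) {t : ℝ}
    (ht : 0 ≤ t) : ENNReal.ofReal ‖y t‖ ≤ l1Norm H * linfNorm u := by
  rw [← ENNReal.ofReal_toReal hu.ne]
  refine h.norm_le (τ := t) (hum.indicator measurableSet_Icc) (fun s hs => ?_) ⟨ht, le_rfl⟩
  rw [← ENNReal.ofReal_le_iff_le_toReal hu.ne]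
  exact le_iSup₂ (f := fun (t : ℝ) (_ : 0 ≤ t) => ENNReal.ofReal ‖u t‖) s hs.1

/-- The bound of the reference trajectory in the coordinates scaled by `S`. -/
theorem scaled_reference_bound {S : Matrix (Fin n) (Fin n) ℝ} (hS : IsUnit S)
    {v : ℝ → Fin m → ℝ} (hv : Measurable v) (hvb : linfNorm v < ⊤) {X₀ : Set (Fin n → ℝ)}
    (hX₀ : IsCompact X₀) {x₀ : Fin n → ℝ} (hx₀ : x₀ ∈ X₀) {xn z : ℝ → Fin n → ℝ}
    (hxn : P.IsNominal v x₀ xn) {φ w : ℝ → Fin m → ℝ}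
    (hz : ∀ σ, TrajOn σ 0 z (fun t => P.Am *ᵥ z t + P.B *ᵥ (φ t - w t))) (hw : Filtered P.k φ w)
    {τ β : ℝ} (hφc : ContinuousOn φ (Icc 0 τ)) (hφ : ∀ s ∈ Icc 0 τ, ‖φ s‖ ≤ β) {t : ℝ}
    (ht : t ∈ Icc 0 τ) :
    ENNReal.ofReal ‖S *ᵥ z t‖ ≤ l1Norm (P.checkGxm S) * ENNReal.ofReal β ∧
    ENNReal.ofReal ‖S *ᵥ (xn t + z t)‖ ≤ l1Norm (P.checkGxm S) * ENNReal.ofReal β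
      + l1Norm (P.checkHxv S) * linfNorm v + P.checkRhoIn S X₀ := by
  have hdet := (Matrix.isUnit_iff_isUnit_det _).mp hS
  have hconj : ∀ a, S *ᵥ (P.Am *ᵥ a) = P.checkAm S *ᵥ (S *ᵥ a) := by
    intro a
    rw [Params.checkAm, Matrix.mulVec_mulVec, Matrix.mulVec_mulVec, Matrix.mul_assoc (S * P.Am),
      Matrix.nonsing_inv_mul _ hdet, Matrix.mul_one]
  -- Superposition: `xi` is the free motion from `x₀`, `xn - xi` the zero-state response to `v`, and
  -- `z` the zero-state response to `φ`. Each accounts for one term of the stability condition.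
  obtain ⟨xi, hxi⟩ := exists_linear_traj P.Am x₀ (f := fun _ => 0)
    (fun _ _ => intervalIntegrable_const)
  simp only [add_zero] at hxi
  have h1 : ENNReal.ofReal ‖S *ᵥ z t‖ ≤ l1Norm (P.checkGxm S) * ENNReal.ofReal β := by
    have hr : Response (P.checkGxm S) φ (fun t => S *ᵥ z t) := by
      refine hw.filteredTransfer fun σ => ?_
      refine ((hz σ).map (mulVecCLM S)).congr' (by simp) (fun _ _ => rfl) fun t _ => ?_
      simp only [mulVecCLM_apply, Matrix.mulVec_add, hconj, Matrix.mulVec_mulVec]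
    exact hr.norm_le (measurable_indicator_Icc hφc) hφ ht
  have h2 : ENNReal.ofReal ‖S *ᵥ (xn t - xi t)‖ ≤ l1Norm (P.checkHxv S) * linfNorm v := by
    have hr : Response (P.checkHxv S) v (fun t => S *ᵥ (xn t - xi t)) := by
      refine .stateTransfer fun σ => ?_
      refine (((solvesFrom_iff.mp hxn σ).sub (hxi σ)).map (mulVecCLM S)).congr' (by simp)
        (fun _ _ => rfl) fun t _ => ?_
      simp only [mulVecCLM_apply, Matrix.mulVec_add, Matrix.mulVec_sub, hconj,
        Matrix.mulVec_mulVec]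
      abel
    exact hr.norm_le_linfNorm hv hvb ht.1
  have h3 : ENNReal.ofReal ‖S *ᵥ xi t‖ ≤ P.checkRhoIn S X₀ := by
    refine (Response.free (S := S) hxi).norm_le (τ := τ)
      (measurable_const.indicator measurableSet_Icc) (fun _ _ => ?_) ht
    exact le_csSup (hX₀.image continuous_norm).bddAbove (mem_image_of_mem _ hx₀)
  refine ⟨h1, ?_⟩
  have h4 : S *ᵥ (xn t + z t) = S *ᵥ z t + S *ᵥ (xn t - xi t) + S *ᵥ xi t := by
    simp only [Matrix.mulVec_add, Matrix.mulVec_sub]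
    abel
  rw [h4]
  calc _ ≤ ENNReal.ofReal (‖S *ᵥ z t‖ + ‖S *ᵥ (xn t - xi t)‖ + ‖S *ᵥ xi t‖) :=
        ENNReal.ofReal_le_ofReal norm_add₃_le
    _ = ENNReal.ofReal ‖S *ᵥ z t‖ + ENNReal.ofReal ‖S *ᵥ (xn t - xi t)‖
        + ENNReal.ofReal ‖S *ᵥ xi t‖ := by
        rw [ENNReal.ofReal_add (by positivity) (by positivity),
          ENNReal.ofReal_add (by positivity) (by positivity)]
    _ ≤ _ := add_le_add (add_le_add h1 h2) h3

end

/-! ### Comparison of the adaptive and the reference system -/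

section

variable {n m : ℕ} {P : Params n m} {f : ℝ → (Fin n → ℝ) → Fin m → ℝ}
  {L l b : Set (Fin n → ℝ) → Fin m → ℝ} {v : ℝ → Fin m → ℝ} {x₀ : Fin n → ℝ}
  {x xhat : ℝ → Fin n → ℝ} {ua : ℝ → Fin m → ℝ}

/-- The predictor uses the measured `x` in its `A_m` term and the same `u_a` as the plant. Both
cancel in the difference, leaving dynamics governed by `A_e` alone. -/
theorem L1Adaptive.Params.IsClosedLoop.predictionError {hmn : m ≤ n}
    (hx : P.IsClosedLoop hmn f v x₀ x xhat ua) (τ : ℝ) :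
    TrajOn τ 0 (xhat - x) (fun t => P.Ae *ᵥ (xhat - x) t
      + (P.BB hmn *ᵥ P.sigmaHat hmn (xhat - x) t - P.B *ᵥ f t (x t))) := by
  refine ((solvesFrom_iff.mp hx.predictor τ).sub (solvesFrom_iff.mp hx.plant τ)).congr' (by simp)
    (fun _ _ => rfl) fun t _ => ?_
  rw [Params.BB_mulVec]
  change P.Ae *ᵥ (xhat t - x t) + (P.B *ᵥ P.sigma1 hmn (xhat - x) t
    + P.Bperp *ᵥ P.sigma2 hmn (xhat - x) t - P.B *ᵥ f t (x t)) = _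
  simp only [Matrix.mulVec_add]
  abel

/-- The deviation of the adaptive system from the reference system, as a response to the mismatch
`f(t, x) - φ` of the uncertainties and to the prediction error. -/
theorem error_decomposition {hmn : m ≤ n} (hperp : P.Bperpᵀ * P.B = 0)
    (hrank : (P.BB hmn).rank = n) (hk : ∀ j, 0 < P.k j)
    (hf : ∀ Z, IsCompact Z → UncertaintyBounds f Z (L Z) (l Z) (b Z))
    {xn z : ℝ → Fin n → ℝ} (hxn : P.IsNominal v x₀ xn)
    (hx : P.IsClosedLoop hmn f v x₀ x xhat ua) {φ w : ℝ → Fin m → ℝ}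
    (hz : ∀ σ, TrajOn σ 0 z (fun t => P.Am *ᵥ z t + P.B *ᵥ (φ t - w t))) (hw : Filtered P.k φ w)
    (hφi : ∀ t, IntervalIntegrable φ volume 0 t) :
    ∃ (g h : ℝ → Fin n → ℝ) (wδ p : ℝ → Fin m → ℝ),
      Response P.Gxm (fun t => f t (x t) - φ t) g ∧
      Response (P.Hxm * P.filterInv) (xhat - x) h ∧
      Response (filterTF P.k) (fun t => f t (x t) - φ t) wδ ∧
      Response P.filterInv (xhat - x) p ∧
      (∀ t, x t - (xn t + z t) = g t - h t) ∧ ∀ t, ua t + w t = -(wδ t + p t) := by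
  set δ : ℝ → Fin m → ℝ := fun t => f t (x t) - φ t with hδ
  set K := Matrix.diagonal P.k with hK
  have hδi : ∀ t, 0 ≤ t → IntervalIntegrable δ volume 0 t := fun t ht =>
    ((continuousOn_uncertainty hf
      (solvesFrom_iff.mp hx.plant t).continuousOn).intervalIntegrable_of_Icc ht).sub (hφi t)
  have hmap : ∀ {q : ℕ} (M : Matrix (Fin q) (Fin m) ℝ) {η : ℝ → Fin m → ℝ} {t : ℝ},
      IntervalIntegrable η volume 0 t → IntervalIntegrable (fun t => M *ᵥ η t) volume 0 t :=
    fun M η t h => ⟨(mulVecCLM M).integrable_comp h.1, (mulVecCLM M).integrable_comp h.2⟩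
  obtain ⟨wδ, hwδ⟩ := exists_linear_traj (-K) 0 (f := fun t => K *ᵥ δ t)
    fun t ht => hmap K (hδi t ht)
  have hwδF : Filtered P.k δ wδ := hwδ
  obtain ⟨g, hg⟩ := exists_linear_traj P.Am 0 (f := fun t => P.B *ᵥ (δ t - wδ t))
    fun t ht => hmap P.B ((hδi t ht).sub ((hwδ t).continuousOn.intervalIntegrable_of_Icc ht))
  set η : ℝ → Fin m → ℝ := fun t => P.sigma1 hmn (xhat - x) t - f t (x t) with hη
  -- Here `u_a = -C(s) σ̂₁`, `w = C(s) φ` and `wδ = C(s) (f - φ)`, so that `p` is the filtered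
  -- estimation error `C(s) η`.
  set p : ℝ → Fin m → ℝ := fun t => -(ua t + w t + wδ t) with hp
  have hpF : Filtered P.k η p := by
    intro τ
    have h1 := ((solvesFrom_iff.mp hx.control τ).add (hw τ)).add (hwδ τ)
    refine (h1.map (-ContinuousLinearMap.id ℝ (Fin m → ℝ))).congr' (by simp) (fun _ _ => rfl)
      fun t _ => ?_
    ext j
    simp only [hη, hp, hδ, hK, Matrix.neg_mulVec, Matrix.mulVec_diagonal, Pi.add_apply,
      Pi.neg_apply, Pi.sub_apply, _root_.neg_apply, ContinuousLinearMap.id_apply]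
    ring
  have hpR : Response P.filterInv (xhat - x) p := by
    refine hpF.response_inverse (fun j => (hk j).ne') fun τ => ?_
    refine ((hx.predictionError τ).map (mulVecCLM (pinv P.B))).congr' (by simp)
      (fun _ _ => rfl) fun t _ => ?_
    rw [Params.BB_mulVec, mulVecCLM_apply, Matrix.mulVec_add, Matrix.mulVec_sub, Matrix.mulVec_add]
    simp only [Matrix.mulVec_mulVec, Params.pinv_mul_self hrank, Params.pinv_mul_perp hperp,
      Matrix.one_mulVec, Matrix.zero_mulVec, add_zero]
    rfl
  -- The second component is defined as what remains after `g`; the equations show that it is driven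
  -- by `p` through `H_xm`.
  refine ⟨g, fun t => g t - (x t - (xn t + z t)), wδ, p, hwδF.filteredTransfer hg, ?_,
    hwδF.response, hpR, fun t => (sub_sub_cancel _ _).symm, fun t => by simp only [hp]; abel⟩
  refine hpR.series (.stateTransfer fun τ => ?_)
  have h1 := (hg τ).sub ((solvesFrom_iff.mp hx.plant τ).sub ((solvesFrom_iff.mp hxn τ).add (hz τ)))
  refine h1.congr' (by simp) (fun _ _ => rfl) fun t _ => ?_
  simp only [hp, hδ, Matrix.mulVec_add, Matrix.mulVec_sub, Matrix.mulVec_neg]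
  abel

/-- Small-gain absorption: `(1 - q) a ≤ c`. Finiteness of `a` is what allows `q * a` to be
subtracted. -/
theorem ENNReal.lt_of_le_mul_add {a q c d : ℝ≥0∞} (ha : a ≠ ⊤) (hq : q < 1)
    (h : a ≤ q * a + c) (hc : c / (1 - q) < d) : a < d := by
  refine lt_of_le_of_lt ?_ hc
  have h1 : 1 - q ≠ 0 := (tsub_pos_of_lt hq).ne'
  rw [ENNReal.le_div_iff_mul_le (Or.inl h1)
    (Or.inl (ne_top_of_le_ne_top ENNReal.one_ne_top tsub_le_self)), mul_comm,
    ENNReal.sub_mul fun _ _ => ha, one_mul]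
  exact tsub_le_iff_left.mpr h

/-- While the deviation from the reference trajectory is at most `γ₁`, it is less than `γ₁`, and the
deviation of the control signal is at most `γ₂`. -/
theorem deviation_bound {hmn : m ≤ n} (hAe : IsHurwitz P.Ae) (hperp : P.Bperpᵀ * P.B = 0)
    (hrank : (P.BB hmn).rank = n) (hk : ∀ j, 0 < P.k j) (hT : 0 < P.T)
    (hf : ∀ Z, IsCompact Z → UncertaintyBounds f Z (L Z) (l Z) (b Z))
    {ρr γ₁ : ℝ} (hγ₁ : 0 < γ₁)
    (hstabL : P.StabCondLip (⨆ j, L (Omega (ρr + γ₁)) j))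
    (hsample : P.SampleCond (⨆ j, L (Omega (ρr + γ₁)) j) (⨆ j, b (Omega (ρr + γ₁)) j) γ₁)
    {xn z : ℝ → Fin n → ℝ} (hxn : P.IsNominal v x₀ xn)
    (hx : P.IsClosedLoop hmn f v x₀ x xhat ua) {φ w : ℝ → Fin m → ℝ}
    (hz : ∀ σ, TrajOn σ 0 z (fun t => P.Am *ᵥ z t + P.B *ᵥ (φ t - w t))) (hw : Filtered P.k φ w)
    (hφi : ∀ t, IntervalIntegrable φ volume 0 t) {τ : ℝ} (hφc : ContinuousOn φ (Icc 0 τ))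
    (hφ : ∀ s ∈ Icc 0 τ, φ s = f s (xn s + z s)) (hr : ∀ s ∈ Icc 0 τ, ‖xn s + z s‖ ≤ ρr)
    (he : ∀ s ∈ Icc 0 τ, ‖x s - (xn s + z s)‖ ≤ γ₁) {t : ℝ} (ht : t ∈ Icc 0 τ) :
    ‖x t - (xn t + z t)‖ < γ₁ ∧ ENNReal.ofReal ‖ua t + w t‖
      ≤ P.gamma2 (⨆ j, L (Omega (ρr + γ₁)) j) (⨆ j, b (Omega (ρr + γ₁)) j) γ₁ := by
  set Lc := ⨆ j, L (Omega (ρr + γ₁)) j with hLc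
  set bc := ⨆ j, b (Omega (ρr + γ₁)) j with hbc
  have hfa := hf _ (isCompact_Omega (n := n) (ρr + γ₁))
  have hL0 : 0 ≤ Lc := hfa.iSup_L_nonneg
  have hxc : ContinuousOn x (Icc 0 τ) := (solvesFrom_iff.mp hx.plant τ).continuousOn
  have hrc : ContinuousOn (fun s => xn s + z s) (Icc 0 τ) :=
    (solvesFrom_iff.mp hxn τ).continuousOn.add (hz τ).continuousOn
  have hFc : ContinuousOn (fun s => f s (x s)) (Icc 0 τ) := continuousOn_uncertainty hf hxc
  have hxa : ∀ s ∈ Icc 0 τ, x s ∈ Omega (ρr + γ₁) := by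
    intro s hs
    have h1 : x s = (xn s + z s) + (x s - (xn s + z s)) := by abel
    change ‖x s‖ ≤ _
    rw [h1]
    exact (norm_add_le _ _).trans (add_le_add (hr s hs) (he s hs))
  have hra : ∀ s ∈ Icc 0 τ, xn s + z s ∈ Omega (ρr + γ₁) := fun s hs =>
    (hr s hs).trans (by linarith)
  obtain ⟨g, h, wδ, p, hg, hh, hwδ, hp, hegh, hua⟩ :=
    error_decomposition hperp hrank hk hf hxn hx hz hw hφi
  have hδm : Measurable ((Icc 0 τ).indicator fun t => f t (x t) - φ t) :=
    measurable_indicator_Icc (hFc.sub hφc)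
  have hδ : ∀ s ∈ Icc 0 τ, ‖f s (x s) - φ s‖ ≤ Lc * ‖x s - (xn s + z s)‖ := fun s hs => by
    rw [hφ s hs]
    exact hfa.norm_sub_le hs.1 (hxa s hs) (hra s hs)
  have hxtm : Measurable ((Icc 0 τ).indicator (xhat - x)) :=
    measurable_indicator_Icc (hx.predictionError τ).continuousOn
  have hxt : ∀ s ∈ Icc 0 τ, ‖(xhat - x) s‖ ≤ P.gamma0 bc := fun s hs =>
    Params.norm_predictionError_le hmn hAe hrank hT (hx.predictionError τ) hFc
      (fun s hs => hfa.norm_le hs.1 (hxa s hs)) hs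
  constructor
  -- At a maximum point `s` the mismatch is at most `Lc * E` on all of `[0, τ]`, so the same number
  -- `E` stands on both sides of the small-gain inequality.
  · obtain ⟨s, hs, hmax⟩ := isCompact_Icc.exists_isMaxOn ⟨t, ht⟩ (hxc.sub hrc).norm
    set E := ‖x s - (xn s + z s)‖ with hE
    have h1 : ENNReal.ofReal E ≤ l1Norm P.Gxm * ENNReal.ofReal Lc * ENNReal.ofReal E
        + l1Norm (P.Hxm * P.filterInv) * ENNReal.ofReal (P.gamma0 bc) := by
      calc ENNReal.ofReal E ≤ ENNReal.ofReal (‖g s‖ + ‖h s‖) := by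
            rw [hE, hegh]
            exact ENNReal.ofReal_le_ofReal (norm_sub_le _ _)
        _ = ENNReal.ofReal ‖g s‖ + ENNReal.ofReal ‖h s‖ :=
            ENNReal.ofReal_add (norm_nonneg _) (norm_nonneg _)
        _ ≤ _ := by
            refine add_le_add ?_ (hh.norm_le hxtm hxt hs)
            rw [mul_assoc, ← ENNReal.ofReal_mul hL0]
            exact hg.norm_le hδm (fun r hr => (hδ r hr).trans
              (mul_le_mul_of_nonneg_left (hmax hr) hL0)) hs
    have h2 := ENNReal.lt_of_le_mul_add ENNReal.ofReal_ne_top hstabL h1 (d := ENNReal.ofReal γ₁)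
      (by rw [ENNReal.mul_div_right_comm]; exact hsample)
    exact lt_of_le_of_lt (hmax ht) ((ENNReal.ofReal_lt_ofReal_iff hγ₁).mp h2)
  · rw [hua, norm_neg]
    calc ENNReal.ofReal ‖wδ t + p t‖ ≤ ENNReal.ofReal (‖wδ t‖ + ‖p t‖) :=
          ENNReal.ofReal_le_ofReal (norm_add_le _ _)
      _ = ENNReal.ofReal ‖wδ t‖ + ENNReal.ofReal ‖p t‖ :=
          ENNReal.ofReal_add (norm_nonneg _) (norm_nonneg _)
      _ ≤ _ := add_le_add (hwδ.norm_le hδm (fun r hr => (hδ r hr).trans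
          (mul_le_mul_of_nonneg_left (he r hr) hL0)) ht) (hp.norm_le hxtm hxt ht)

/-- A continuous function that starts below `c`, and that stays strictly below `c` on every initial
interval on which it is at most `c`, is below `c`. -/
theorem le_of_forall_prefix {e : ℝ → ℝ} {τ c : ℝ} (he : ContinuousOn e (Icc 0 τ)) (h0 : e 0 < c)
    (h : ∀ σ ∈ Icc 0 τ, (∀ s ∈ Icc 0 σ, e s ≤ c) → e σ < c) : ∀ s ∈ Icc 0 τ, e s ≤ c := by
  by_contra! hcon
  obtain ⟨s₁, hs₁, hs₁c⟩ := hcon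
  -- At the first time when `e` reaches `c`, the function is at most `c` on the whole closed prefix,
  -- so the hypothesis contradicts the choice of that time.
  set S := Icc 0 τ ∩ e ⁻¹' Ici c with hS
  have hSc : IsCompact S :=
    isCompact_Icc.of_isClosed_subset (he.preimage_isClosed_of_isClosed isClosed_Icc isClosed_Ici)
      inter_subset_left
  obtain ⟨σ, ⟨hσ, hσc⟩, hmin⟩ := hSc.exists_isLeast ⟨s₁, hs₁, hs₁c.le⟩
  have hlt : ∀ s ∈ Ico 0 σ, e s < c := by
    intro s hs
    by_contra! hsc
    exact absurd (hmin ⟨⟨hs.1, hs.2.le.trans hσ.2⟩, hsc⟩) (not_le.mpr hs.2)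
  have hσ0 : 0 < σ := by
    rcases hσ.1.eq_or_lt with h1 | h1
    · rw [← h1] at hσc
      exact absurd hσc (not_le.mpr h0)
    · exact h1
  have hle : ∀ s ∈ Icc 0 σ, e s ≤ c := by
    have h1 : closure (Ico 0 σ) = Icc 0 σ := closure_Ico hσ0.ne
    intro s hs
    refine le_on_closure (s := Ico 0 σ) (fun s hs => (hlt s hs).le) ?_ continuousOn_const
      (h1 ▸ hs)
    rw [h1]
    exact he.mono (Icc_subset_Icc_right hσ.2)
  exact absurd (h σ hσ hle) (not_lt.mpr hσc)

end

/-! ### The componentwise bounds -/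

theorem norm_le_of_ofReal_lt {a c : ℝ} {B : ℝ≥0∞} (h : ENNReal.ofReal a ≤ B)
    (hB : B < ENNReal.ofReal c) (hc : 0 < c) : a ≤ c :=
  ((ENNReal.ofReal_lt_ofReal_iff hc).mp (h.trans_lt hB)).le

/-- The purpose of the scalings: the `i`-th coordinate keeps weight `1`, so the scaled norm still
dominates it even if the other coordinates are shrunk. -/
theorem abs_apply_le_norm_diagonal_mulVec {n : ℕ} {s : Fin n → ℝ} {i : Fin n} (hs : s i = 1)
    (y : Fin n → ℝ) : |y i| ≤ ‖Matrix.diagonal s *ᵥ y‖ := by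
  have h := norm_le_pi_norm (Matrix.diagonal s *ᵥ y) i
  rwa [Matrix.mulVec_diagonal, hs, one_mul, Real.norm_eq_abs] at h

theorem mainTheorem2 {n m : ℕ} (hmn : m ≤ n) (P : Params n m)
    -- design assumptions
    (hAm : IsHurwitz P.Am) (hAe : IsHurwitz P.Ae)
    (hperp : P.Bperpᵀ * P.B = 0) (hrank : (P.BB hmn).rank = n)
    (hk : ∀ j, 0 < P.k j) (hT : 0 < P.T)
    -- the uncertainty: on every compact `Z` it obeys the constants `L Z`, `l Z`, `b Z`
    (f : ℝ → (Fin n → ℝ) → Fin m → ℝ) (L l b : Set (Fin n → ℝ) → Fin m → ℝ)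
    (hf : ∀ Z, IsCompact Z → UncertaintyBounds f Z (L Z) (l Z) (b Z))
    -- reference command and initial states
    (v : ℝ → Fin m → ℝ) (hv : Measurable v) (hvb : linfNorm v < ⊤)
    (X₀ : Set (Fin n → ℝ)) (hX₀ : IsCompact X₀) (x₀ : Fin n → ℝ) (hx₀ : x₀ ∈ X₀)
    -- stability conditions with `X_r = Ω(ρ_r)`, `X_a = Ω(ρ_r + γ₁)`, and sample-time constraint
    (ρr γ₁ : ℝ) (hρr : 0 < ρr) (hγ₁ : 0 < γ₁)
    (hstab : P.StabCond v X₀ (⨆ j, b (Omega ρr) j) ρr)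
    (hstabL : P.StabCondLip (⨆ j, L (Omega (ρr + γ₁)) j))
    (hsample : P.SampleCond (⨆ j, L (Omega (ρr + γ₁)) j) (⨆ j, b (Omega (ρr + γ₁)) j) γ₁)
    -- the diagonal scalings `𝖳^i = diag(S i)`
    (S : Fin n → Fin n → ℝ) (hS1 : ∀ i, S i i = 1) (hS : ∀ i k, 0 < S i k ∧ S i k ≤ 1)
    -- a bound for the transformed uncertainty on the transformed set `X_r = Ω(ρ_r)`
    (bc : Fin n → Fin m → ℝ)
    (hbc : ∀ i, ∀ t : ℝ, 0 ≤ t → ∀ z ∈ checkSet (Matrix.diagonal (S i)) (Omega ρr), ∀ j,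
      |checkFun (Matrix.diagonal (S i)) f t z j| ≤ bc i j)
    -- the transformed stability conditions with constants `ρ̌_r^i`
    (ρc : Fin n → ℝ) (hρc : ∀ i, 0 < ρc i)
    (hstabc : ∀ i, P.CheckStabCond (Matrix.diagonal (S i)) v X₀ (⨆ j, bc i j) (ρc i))
    -- trajectories of the nominal and of the adaptive closed-loop system
    (xn x xhat : ℝ → Fin n → ℝ) (ua : ℝ → Fin m → ℝ)
    (hxn : P.IsNominal v x₀ xn) (hx : P.IsClosedLoop hmn f v x₀ x xhat ua)
    -- the total input `u` and the nominal input `u_n`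
    (u un : ℝ → Fin m → ℝ) (hu : ∀ t, u t = P.baseline v x t + ua t)
    (hun : ∀ t, un t = P.baseline v xn t)
    -- the constants `ρ̃^i`, `γ₂`, `ρ_{u_a}^j`; here `X_r` is the box with half-widths `ρ̌_r^i`
    (ρt : Fin n → ℝ≥0∞)
    (hρt : ∀ i, ρt i = P.rhoTilde (Matrix.diagonal (S i)) (⨆ j, b (box ρc) j) γ₁)
    (γ₂ : ℝ≥0∞)
    (hγ₂ : γ₂ = P.gamma2 (⨆ j, L (Omega (ρr + γ₁)) j) (⨆ j, b (Omega (ρr + γ₁)) j) γ₁)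
    (ρua : Fin m → ℝ≥0∞) (hρua : ∀ j, ρua j = P.rhoUa j (b (box ρc) j) γ₂) :
    ∀ t : ℝ, 0 ≤ t →
      (∀ i, ENNReal.ofReal |x t i - xn t i| ≤ ρt i) ∧
      (∀ j, ENNReal.ofReal |ua t j| ≤ ρua j) ∧
      (∀ j, ENNReal.ofReal |u t j - un t j|
        ≤ ρua j + ∑ i, ENNReal.ofReal |P.Kx j i| * ρt i) := by

  -- The evaluation time serves as the horizon: `φ` is tied to `f` only on `[0, τ]`, and the bounds
  -- are read off at its right end.
  intro τ hτ
  have hτm : τ ∈ Icc 0 τ := ⟨hτ, le_rfl⟩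
  have hxnc : ContinuousOn xn (Icc 0 τ) := (solvesFrom_iff.mp hxn τ).continuousOn
  obtain ⟨z, φ, w, hz, hw, hφi, hφc, hφ⟩ := exists_reference (P := P) hf hρr.le hτ hxnc
  have hfr := hf _ (isCompact_Omega (n := n) ρr)
  -- the cut-off is inactive along the reference trajectory
  have hr : ∀ s ∈ Icc 0 τ, ‖xn s + z s‖ ≤ ρr := by
    intro s hs
    -- For `S = 1` this is the unscaled estimate. The cut-off bounds `φ` before the location of
    -- `x_r` is known, so no continuation argument is needed.
    have h1 := (scaled_reference_bound (S := 1) isUnit_one hv hvb hX₀ hx₀ hxn hz hw hφc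
      (fun s hs => by rw [hφ s hs]; exact hfr.norm_le hs.1 (clampBall_mem hρr.le _)) hs).2
    simp only [Params.checkGxm, Params.checkHxv, Params.checkAm, Params.checkRhoIn, gain_one,
      Matrix.one_mul, Matrix.one_mulVec, inv_one, Matrix.mul_one] at h1
    exact norm_le_of_ofReal_lt h1 hstab hρr
  have hφ' : ∀ s ∈ Icc 0 τ, φ s = f s (xn s + z s) := fun s hs => by
    rw [hφ s hs, clampBall_eq (hr s hs)]
  -- the reference trajectory stays in the box
  have hSu : ∀ i, IsUnit (Matrix.diagonal (S i)) := fun i => by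
    rw [Matrix.isUnit_diagonal, Pi.isUnit_iff]
    exact fun k => (hS i k).1.ne'.isUnit
  have hbox : ∀ s ∈ Icc 0 τ, xn s + z s ∈ box ρc := by
    intro s hs i
    have hdet := (Matrix.isUnit_iff_isUnit_det _).mp (hSu i)
    have hSS : ∀ y, (Matrix.diagonal (S i))⁻¹ *ᵥ (Matrix.diagonal (S i) *ᵥ y) = y := fun y => by
      rw [Matrix.mulVec_mulVec, Matrix.nonsing_inv_mul _ hdet, Matrix.one_mulVec]
    have hφb : ∀ s ∈ Icc 0 τ, ‖φ s‖ ≤ ⨆ j, bc i j := by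
      intro s hs
      have h1 : ∀ j, |φ s j| ≤ bc i j := fun j => by
        have h2 := hbc i s hs.1 (Matrix.diagonal (S i) *ᵥ (xn s + z s))
          (by rw [checkSet, Set.mem_ofPred_eq, hSS]; exact hr s hs) j
        rwa [checkFun, hSS, ← hφ' s hs] at h2
      exact (pi_norm_le_iff_of_nonneg (Real.iSup_nonneg fun j => (abs_nonneg _).trans (h1 j))).mpr
        fun j => (h1 j).trans (le_ciSup_fin _ j)
    have h1 := (scaled_reference_bound (hSu i) hv hvb hX₀ hx₀ hxn hz hw hφc hφb hs).2
    exact (abs_apply_le_norm_diagonal_mulVec (hS1 i) _).trans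
      (norm_le_of_ofReal_lt h1 (hstabc i) (hρc i))
  have hfb := hf _ (isCompact_box ρc)
  -- Confinement to the box makes available the bound of `f` that appears in `ρt`.
  have hφbox : ∀ s ∈ Icc 0 τ, ‖φ s‖ ≤ ⨆ j, b (box ρc) j := fun s hs => by
    rw [hφ' s hs]; exact hfb.norm_le hs.1 (hbox s hs)
  -- the adaptive trajectory stays close to the reference trajectory
  have hxc : ContinuousOn x (Icc 0 τ) := (solvesFrom_iff.mp hx.plant τ).continuousOn
  have hrc : ContinuousOn (fun s => xn s + z s) (Icc 0 τ) := hxnc.add (hz τ).continuousOn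
  have hdev : ∀ σ ∈ Icc 0 τ, (∀ s ∈ Icc 0 σ, ‖x s - (xn s + z s)‖ ≤ γ₁) →
      ‖x σ - (xn σ + z σ)‖ < γ₁ ∧ ENNReal.ofReal ‖ua σ + w σ‖ ≤ γ₂ := by
    intro σ hσ he
    have hsub : Icc 0 σ ⊆ Icc 0 τ := Icc_subset_Icc_right hσ.2
    rw [hγ₂]
    exact deviation_bound hAe hperp hrank hk hT hf hγ₁ hstabL hsample hxn hx hz hw hφi
      (hφc.mono hsub) (fun s hs => hφ' s (hsub hs)) (fun s hs => hr s (hsub hs)) he ⟨hσ.1, le_rfl⟩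
  have he0 : ‖x 0 - (xn 0 + z 0)‖ < γ₁ := by
    rw [(solvesFrom_iff.mp hx.plant τ).init hτ, (solvesFrom_iff.mp hxn τ).init hτ, (hz τ).init hτ]
    simpa using hγ₁
  have he := le_of_forall_prefix (hxc.sub hrc).norm he0 fun σ hσ h => (hdev σ hσ h).1
  obtain ⟨heτ, huτ⟩ := hdev τ hτm he
  have hstate : ∀ i, ENNReal.ofReal |x τ i - xn τ i| ≤ ρt i := by
    intro i
    -- Only `z` is measured in the scaled norm; the deviation from the reference is at most `γ₁` in
    -- the plain norm.
    have h1 : |x τ i - xn τ i| ≤ ‖Matrix.diagonal (S i) *ᵥ z τ‖ + γ₁ := by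
      have h2 : x τ i - xn τ i = z τ i + (x τ - (xn τ + z τ)) i := by
        simp only [Pi.sub_apply, Pi.add_apply]; ring
      rw [h2]
      exact (abs_add_le _ _).trans (add_le_add (abs_apply_le_norm_diagonal_mulVec (hS1 i) _)
        ((norm_le_pi_norm _ i).trans heτ.le))
    rw [hρt i, Params.rhoTilde]
    refine (ENNReal.ofReal_le_ofReal h1).trans ?_
    rw [ENNReal.ofReal_add (norm_nonneg _) hγ₁.le]
    gcongr
    exact (scaled_reference_bound (hSu i) hv hvb hX₀ hx₀ hxn hz hw hφc hφbox hτm).1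
  have hctrl : ∀ j, ENNReal.ofReal |ua τ j| ≤ ρua j := by
    intro j
    -- The reference input is `-w`. Its channel `j` is treated as a scalar system, so that only
    -- `C_j` and the bound of `f_j` enter.
    have h1 : |ua τ j| ≤ ‖(fun _ : Fin 1 => w τ j)‖ + ‖ua τ + w τ‖ := by
      have h2 : ua τ j = -(w τ j) + (ua τ + w τ) j := by
        simp only [Pi.add_apply]; ring
      rw [h2]
      refine (abs_add_le _ _).trans (add_le_add ?_ (norm_le_pi_norm (ua τ + w τ) j))
      rw [abs_neg]
      exact norm_le_pi_norm (fun _ : Fin 1 => w τ j) 0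
    rw [hρua j, Params.rhoUa]
    refine (ENNReal.ofReal_le_ofReal h1).trans ?_
    rw [ENNReal.ofReal_add (norm_nonneg _) (norm_nonneg _)]
    refine add_le_add ?_ huτ
    refine (hw.response_entry j).norm_le (τ := τ) (measurable_indicator_Icc
      (continuousOn_pi.mpr fun _ => continuousOn_pi.mp hφc j)) (fun s hs => ?_) hτm
    refine (pi_norm_le_iff_of_nonneg (hfb j).2.2.1.le).mpr fun _ => ?_
    rw [hφ' s hs]
    exact ((hfb j).2.2.2 _ (hbox s hs) _ (hbox s hs) s s hs.1 hs.1).2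
  refine ⟨hstate, hctrl, fun j => ?_⟩
  have h1 : u τ j - un τ j = ua τ j + ∑ i, P.Kx j i * (x τ i - xn τ i) := by
    have h2 : ∑ i, P.Kx j i * (x τ i - xn τ i) = (P.Kx *ᵥ (x τ - xn τ)) j := rfl
    rw [h2, hu, hun, Matrix.mulVec_sub]
    simp only [Params.baseline, Pi.add_apply, Pi.sub_apply]
    ring
  rw [h1]
  calc ENNReal.ofReal |ua τ j + ∑ i, P.Kx j i * (x τ i - xn τ i)|
      ≤ ENNReal.ofReal (|ua τ j| + ∑ i, |P.Kx j i| * |x τ i - xn τ i|) := by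
        refine ENNReal.ofReal_le_ofReal ((abs_add_le _ _).trans (add_le_add le_rfl ?_))
        refine (Finset.abs_sum_le_sum_abs _ _).trans (le_of_eq ?_)
        simp only [abs_mul]
    _ = ENNReal.ofReal |ua τ j|
        + ∑ i, ENNReal.ofReal |P.Kx j i| * ENNReal.ofReal |x τ i - xn τ i| := by
        rw [ENNReal.ofReal_add (abs_nonneg _) (Finset.sum_nonneg fun _ _ => by positivity),
          ENNReal.ofReal_sum_of_nonneg fun _ _ => by positivity]
        simp only [ENNReal.ofReal_mul (abs_nonneg _)]
    _ ≤ _ := by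
        gcongr with i
        · exact hctrl j
        · exact hstate i
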